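/- Let $\mathcal H$ be a complex Hilbert space, $A$ a (possibly unbounded) self-adjoint operator on $\mathcal H$, and $H$ a bounded self-adjoint operator on $\mathcal H$ of class $C^2(A)$, i.e. for some $z\in\rho(H)$ the map $t\mapsto e^{itA}(H-z)^{-1}e^{-itA}$ is $C^2$ in the strong operator topology ($C^1(A)$ is defined in the same way). For a bounded operator $T$ let $[T,A]$ be the bounded operator which is the strong derivative at $t=0$ of $t\mapsto i\,e^{itA}Te^{-itA}$, whenever it exists, and put $[H,iA]=i[H,A]$ and $\langle A\rangle=(1+A^2)^{1/2}$. Let $J\subset\mathbb R$ be open and bounded and $a>0$, and suppose that $H$ obeys a Mourre estimate on $J$ with conjugate operator $A$ and constant $a$, i.e. $$E(J)\,[H,iA]\,E(J)\ \ge\ a\,E(J),$$ where $E$ is the spectral measure of $H$. Let $I=[\alpha,\beta]$ ($\alpha\le\beta$) be a compact interval and $\delta>0$ with $I+[-\delta,\delta]\subset J$, and let $\nu>1/2$. Then the commutators $[H,A]$ and $[[H,A],A]$ exist as bounded operators, and for both choices of the sign $$\sup_{\lambda\in I,\ \mu\in(0,1)}\big\|\langle A\rangle^{-\nu}(H-\lambda\mp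 i\mu)^{-1}\langle A\rangle^{-\nu}\big\|\ \le\ \left[\left(\frac{4}{a\varepsilon_0}+\frac{c_3\varepsilon_0^{\nu}}{\nu}\right)^{1/2}+\frac{c_3\,\varepsilon_0^{\nu-\frac12}}{\nu-\frac12}\right]^2 e^{c_3\varepsilon_0},$$ where $$c_1=\|H\|+\|[H,A]\|+\Big(1+\frac4a\Big)\|[H,A]\|^2+\|[[H,A],A]\|+a+|\alpha|+|\beta|+1,$$ $$c_2=\sqrt{\frac2a}+\frac1\delta\sqrt{\frac{8c_1}{a}},\qquad c_3=4c_2+2c_1c_2^2,\qquad \varepsilon_0=\min\left\{\frac{\sqrt a\,\delta}{4c_1},\ \frac{\delta^2}{16c_1^2}\right\}.$$ -/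

import Mathlib

open MeasureTheory CompactlySupported
open scoped Pointwise InnerProductSpace

namespace Mourre

noncomputable section

universe u

variable {E : Type u} [NormedAddCommGroup E] [InnerProductSpace ℂ E] [CompleteSpace E]

/-! ### Functions of an unbounded self-adjoint operator -/

/-- `U` is the strongly continuous one-parameter unitary group `t ↦ exp (i t A)`: its infinitesimal
generator is exactly `i A`, i.e. `x ∈ D(A)` and `A x = y` if and only if `t ↦ U t x` is
differentiable at `0` with derivative `i y`. -/
structure IsUnitaryGroupOf (A : E →ₗ.[ℂ] E) (U : ℝ → E →L[ℂ] E) : Prop where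
  unitary : ∀ t, U t ∈ _root_.unitary (E →L[ℂ] E)
  zero : U 0 = 1
  add : ∀ s t, U (s + t) = U s * U t
  strongly_continuous : ∀ x, Continuous fun t => U t x
  generator : ∀ x y : E, (x, y) ∈ A.graph ↔ HasDerivAt (fun t => U t x) (Complex.I • y) 0

/-- The unitary group `t ↦ exp (i t A)` of a self-adjoint operator `A`. -/
def expI (A : E →ₗ.[ℂ] E) : ℝ → E →L[ℂ] E :=
  Classical.epsilon (IsUnitaryGroupOf A)

/-- `S` is the bounded operator `(1 + A²)⁻¹`: for all `x`, the vector `S x` lies in `D(A²)`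
and `(1 + A²) S x = x` (here `w = A S x`). -/
def IsInvOneAddSq (A : E →ₗ.[ℂ] E) (S : E →L[ℂ] E) : Prop :=
  ∀ x : E, ∃ w : E, (S x, w) ∈ A.graph ∧ (w, x - S x) ∈ A.graph

/-- The bounded operator `(1 + A²)⁻¹` of a self-adjoint operator `A`. -/
def invOneAddSq (A : E →ₗ.[ℂ] E) : E →L[ℂ] E :=
  Classical.epsilon (IsInvOneAddSq A)

/-- `⟨A⟩^(-ν) = (1 + A²)^(-ν/2)` for `ν > 0`, as the power `ν/2` of the positive contraction
`(1 + A²)⁻¹` in the continuous functional calculus. -/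
def japNegPow (A : E →ₗ.[ℂ] E) (ν : ℝ) : E →L[ℂ] E :=
  cfc (fun s : ℝ => s ^ (ν / 2)) (invOneAddSq A)

/-! ### The spectral measure of a bounded self-adjoint operator -/

/-- The positive linear functional `φ ↦ ⟪x, φ(H) x⟫` on `C_c(ℝ, ℝ)`. -/
def spectralFunctional (H : E →L[ℂ] E) (x : E) : C_c(ℝ, ℝ) →ₚ[ℝ] ℝ :=
  PositiveLinearMap.mk₀
    { toFun := fun φ => (⟪x, cfc (fun r : ℝ => φ r) H x⟫_ℂ).re
      map_add' := fun φ ψ => by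
        have h : cfc (fun r : ℝ => (φ + ψ) r) H
            = cfc (fun r : ℝ => φ r) H + cfc (fun r : ℝ => ψ r) H :=
          cfc_add H (fun r : ℝ => φ r) (fun r : ℝ => ψ r)
            φ.continuous.continuousOn ψ.continuous.continuousOn
        rw [h]
        simp
      map_smul' := fun c φ => by
        have h : cfc (fun r : ℝ => (c • φ) r) H = c • cfc (fun r : ℝ => φ r) H :=
          cfc_smul c (fun r : ℝ => φ r) H φ.continuous.continuousOn
        rw [h]
        simp [inner_smul_right_eq_smul] }
    (fun φ hφ => by
      have h : (0 : E →L[ℂ] E) ≤ cfc (fun r : ℝ => φ r) H := cfc_nonneg fun r _ => hφ r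
      have h' := (ContinuousLinearMap.nonneg_iff_isPositive _).1 h
      exact h'.re_inner_nonneg_right x)

/-- The spectral distribution `S ↦ ⟪x, E(S) x⟫ = ‖E(S) x‖²` of `H` in the vector `x`: the measure
that represents `φ ↦ ⟪x, φ(H) x⟫`. -/
def spectralDistribution (H : E →L[ℂ] E) (x : E) : Measure ℝ :=
  RealRMK.rieszMeasure (spectralFunctional H x)

/-- The closed subspace `{x | ‖E(ℝ \ S) x‖² = 0}`, the range of `E(S)`. (The set is itself a
closed subspace for Borel `S`; the closed span only provides the bundled structure.) -/
def spectralSubspace (H : E →L[ℂ] E) (S : Set ℝ) : Submodule ℂ E :=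
  (Submodule.span ℂ {x : E | spectralDistribution H x Sᶜ = 0}).topologicalClosure

/-- The spectral measure `S ↦ E(S)` of the bounded self-adjoint operator `H`: the orthogonal
projection onto the spectral subspace of the Borel set `S`. -/
def spectralMeasure (H : E →L[ℂ] E) (S : Set ℝ) : E →L[ℂ] E :=
  haveI : CompleteSpace (spectralSubspace H S) :=
    (Submodule.isClosed_topologicalClosure _).completeSpace_coe
  (spectralSubspace H S).starProjection

/-! ### Regularity classes, commutators and the Mourre estimate -/

/-- The resolvent `(H - z)⁻¹`. -/
def resolv (H : E →L[ℂ] E) (z : ℂ) : E →L[ℂ] E :=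
  Ring.inverse (H - z • (1 : E →L[ℂ] E))

/-- `H ∈ C^k(A)` for a bounded self-adjoint operator `H`: for some `z` in the resolvent set,
`t ↦ exp(itA) (H - z)⁻¹ exp(-itA)` is a `C^k`-map in the strong operator topology. -/
def IsOfClass (A : E →ₗ.[ℂ] E) (k : ℕ∞) (H : E →L[ℂ] E) : Prop :=
  IsSelfAdjoint H ∧ ∃ z ∈ resolventSet ℂ H, ∀ x : E,
    ContDiff ℝ (k : WithTop ℕ∞) fun t : ℝ => expI A t (resolv H z (expI A (-t) x))

/-- The bounded operator `C` is the commutator `[T, A]`, the strong derivative at `t = 0` of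
`t ↦ i exp(itA) T exp(-itA)`. -/
def IsCommutator (A : E →ₗ.[ℂ] E) (T C : E →L[ℂ] E) : Prop :=
  ∀ x : E, HasDerivAt (fun t : ℝ => Complex.I • expI A t (T (expI A (-t) x))) (C x) 0

/-- The commutator `[T, A]` of a bounded operator `T` with the self-adjoint operator `A`. -/
def commutator (T : E →L[ℂ] E) (A : E →ₗ.[ℂ] E) : E →L[ℂ] E :=
  Classical.epsilon (IsCommutator A T)

/-- The bounded self-adjoint operator `H` obeys a Mourre estimate on the bounded open set `J`
with conjugate operator `A` and constant `a > 0`: `H ∈ C¹(A)` and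
`E(J) [H, iA] E(J) ≥ a E(J)`. -/
structure MourreEstimate (H : E →L[ℂ] E) (A : E →ₗ.[ℂ] E) (J : Set ℝ) (a : ℝ) : Prop where
  isOpen : IsOpen J
  isBounded : Bornology.IsBounded J
  pos : 0 < a
  isOfClass : IsOfClass A 1 H
  le : a • spectralMeasure H J
    ≤ spectralMeasure H J * (Complex.I • commutator H A) * spectralMeasure H J

end

end Mourre

/-! This is Mourre's differential inequality method with every constant tracked. Let C = [H,A] and B
= iC = [H,iA], and replace (H - z)⁻¹ by G_ε = (H - z + εC)⁻¹ = (H - z - iεB)⁻¹, so that positivity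
of B acts as an additional imaginary part of size ε.

The estimate on J is first made global: a/2 ‖y‖² ≤ Re⟪y, By⟫ + κ‖(H - λ)y‖² for all y, since the
component of y outside the range of E(J) has energy at distance at least δ from λ
(`MourreEstimate.le_re_inner`, `norm_sub_spectralMeasure_apply_le`). The imaginary part of ⟪y, (H -
z - iεB)y⟫ then yields coercivity (`EnergyData.le_norm_inner`). Hence G_ε exists, ‖G_ε‖ is O(1/ε)
for small ε, and ‖G_ε D‖² is controlled by ‖D G_ε D‖/ε + 2κ for a self-adjoint contraction D.

To reach ε = 0, put F(ε) = D_ε G_ε D_ε with weights D_ε tending to ⟨A⟩^(-σ). The dangerous term D G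
C G D of F′ is, up to a term with ε[[H,A],A], the commutator of G with A; there A falls on the
weights, at cost ‖A D_ε‖ ≤ ε^(σ-1). So ‖F′‖ is bounded by multiples of ε^(σ-1), ε^(σ-3/2)‖F‖^(1/2)
and ‖F‖ (`EnergyData.exists_hasDerivAt_weighted`). All coefficients are integrable at 0 because σ >
1/2, and a nonlinear Gronwall inequality started at ε₀ (`norm_le_of_norm_deriv_lt_sqrt`) bounds F
uniformly.

This settles ν ≤ 1 with σ = ν. For ν > 1 the case ν = 1 of the claim is not enough, because the
claimed bound decreases in ν. Sharper constants at σ = 1 give 4/(aε₀)·exp(c₃ε₀), which lies below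
the claimed bound for every ν. The other sign of μ follows by taking adjoints. -/

namespace Mourre

open Filter Topology Complex

/-! ### Unbounded self-adjoint operators: resolvents on the imaginary axis. -/

section SelfAdjoint

variable {E : Type*} [NormedAddCommGroup E] [InnerProductSpace ℂ E] [CompleteSpace E]
  {A : E →ₗ.[ℂ] E}

/-! ### Resolvents of an unbounded self-adjoint operator -/

theorem graph_inner_eq (hA : IsSelfAdjoint A) {x w y v : E} (hx : (x, w) ∈ A.graph)
    (hy : (y, v) ∈ A.graph) : ⟪w, y⟫_ℂ = ⟪x, v⟫_ℂ := by
  obtain ⟨x', rfl, rfl⟩ := A.mem_graph_iff.1 hx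
  obtain ⟨y', rfl, rfl⟩ := A.mem_graph_iff.1 hy
  have h := LinearPMap.adjoint_isFormalAdjoint hA.dense_domain
  rw [LinearPMap.isSelfAdjoint_def.1 hA] at h
  exact h x' y'

/-- The half D(A*) ⊆ D(A) of self-adjointness, through which vectors are shown to belong to the
domain. -/
theorem mem_graph_of_inner_eq (hA : IsSelfAdjoint A) {x w : E}
    (h : ∀ y v : E, (y, v) ∈ A.graph → ⟪w, y⟫_ℂ = ⟪x, v⟫_ℂ) : (x, w) ∈ A.graph := by
  have h' : ∀ y : A.domain, ⟪w, (y : E)⟫_ℂ = ⟪x, A y⟫_ℂ := fun y => h y (A y) (A.mem_graph y)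
  have hx : x ∈ (LinearPMap.adjoint A).domain :=
    LinearPMap.mem_adjoint_domain_of_exists x ⟨w, h'⟩
  have hw : LinearPMap.adjoint A ⟨x, hx⟩ = w :=
    LinearPMap.adjoint_apply_eq hA.dense_domain ⟨x, hx⟩ h'
  have hm : (x, w) ∈ (LinearPMap.adjoint A).graph :=
    (LinearPMap.mem_graph_iff _).2 ⟨⟨x, hx⟩, rfl, hw⟩
  rwa [LinearPMap.isSelfAdjoint_def.1 hA] at hm

theorem graph_inner_im (hA : IsSelfAdjoint A) {x w : E} (hx : (x, w) ∈ A.graph) :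
    (⟪x, w⟫_ℂ).im = 0 := by
  have h := graph_inner_eq hA hx hx
  rw [← inner_conj_symm] at h
  exact Complex.conj_eq_iff_im.1 h

/-- Since ⟪x, Ax⟫ is real, ⟪x, (A - iκ)x⟫ has imaginary part -κ‖x‖²; Cauchy–Schwarz does the rest.
-/
theorem norm_le_of_graph (hA : IsSelfAdjoint A) (κ : ℝ) {x w : E} (hx : (x, w) ∈ A.graph) :
    |κ| * ‖x‖ ≤ ‖w - (I * κ) • x‖ := by
  have h : (⟪x, w - (I * κ) • x⟫_ℂ).im = - κ * ‖x‖ ^ 2 := by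
    rw [inner_sub_right, inner_smul_right, Complex.sub_im, graph_inner_im hA hx,
      inner_self_eq_norm_sq_to_K]
    simp [← Complex.ofReal_pow]
  have h2 : |κ| * ‖x‖ ^ 2 ≤ ‖x‖ * ‖w - (I * κ) • x‖ := by
    have := (Complex.abs_im_le_norm _).trans (norm_inner_le_norm (𝕜 := ℂ) x (w - (I * κ) • x))
    rwa [h, abs_mul, abs_neg, abs_of_nonneg (sq_nonneg ‖x‖)] at this
  rcases (norm_nonneg x).eq_or_lt with h0 | h0
  · rw [← h0, mul_zero]; exact norm_nonneg _
  · nlinarith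

/-- `R` is the resolvent `(A - iκ)⁻¹`. -/
def IsResolventAt (A : E →ₗ.[ℂ] E) (κ : ℝ) (R : E →L[ℂ] E) : Prop :=
  ∀ y, (R y, y + (I * κ) • R y) ∈ A.graph

theorem exists_resolvent (hA : IsSelfAdjoint A) {κ : ℝ} (hκ : κ ≠ 0) :
    ∃ R : E →L[ℂ] E, IsResolventAt A κ R := by
  have hcl : IsClosed (A.graph : Set (E × E)) := hA.isClosed
  have : CompleteSpace A.graph := hcl.completeSpace_coe
  let L : A.graph →L[ℂ] E :=
    (ContinuousLinearMap.snd ℂ E E - (I * κ) • ContinuousLinearMap.fst ℂ E E) ∘L A.graph.subtypeL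
  have hL : ∀ p : A.graph, L p = p.1.2 - (I * κ) • p.1.1 := fun p => rfl
  have hκ' : 0 < |κ| := abs_pos.2 hκ
  have h1 : ∀ p : A.graph, |κ| * ‖p.1.1‖ ≤ ‖L p‖ := fun p => norm_le_of_graph hA κ p.2
  -- A - iκ, as a bounded map on the complete graph, is bounded below. Its range is therefore
  -- closed, and only density remains.
  have hanti : AntilipschitzWith (Real.toNNReal (|κ|⁻¹ + 2)) L := by
    refine ContinuousLinearMap.antilipschitz_of_bound L fun p => ?_
    rw [Real.coe_toNNReal _ (by positivity)]
    have hx := h1 p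
    have hw : ‖p.1.2‖ ≤ 2 * ‖L p‖ := by
      have : p.1.2 = L p + (I * κ) • p.1.1 := by rw [hL]; abel
      calc ‖p.1.2‖ = ‖L p + (I * κ) • p.1.1‖ := by rw [← this]
        _ ≤ ‖L p‖ + |κ| * ‖p.1.1‖ := by
            refine (norm_add_le _ _).trans ?_
            rw [norm_smul, norm_mul, Complex.norm_I, one_mul, Complex.norm_real, Real.norm_eq_abs]
        _ ≤ 2 * ‖L p‖ := by linarith
    have hx' : ‖p.1.1‖ ≤ |κ|⁻¹ * ‖L p‖ := by
      rw [inv_mul_eq_div, le_div_iff₀ hκ']; linarith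
    have hn : 0 ≤ ‖L p‖ := norm_nonneg _
    have hk : 0 ≤ |κ|⁻¹ * ‖L p‖ := by positivity
    refine (max_le ?_ ?_ : max ‖p.1.1‖ ‖p.1.2‖ ≤ _) <;> nlinarith
  have hker : (L : A.graph →ₗ[ℂ] E).ker = ⊥ := LinearMap.ker_eq_bot.2 hanti.injective
  have hrange : (L : A.graph →ₗ[ℂ] E).range = ⊤ := by
    have hc : IsClosed (((L : A.graph →ₗ[ℂ] E).range : Submodule ℂ E) : Set E) :=
      hanti.isClosed_range L.uniformContinuous
    have : CompleteSpace (L : A.graph →ₗ[ℂ] E).range := hc.completeSpace_coe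
    rw [← Submodule.orthogonal_eq_bot_iff, Submodule.eq_bot_iff]
    -- A vector orthogonal to the range would satisfy Aw = -iκw, which is incompatible with ⟪w, Aw⟫
    -- being real unless w = 0.
    intro w hw
    have hg : (w, (-(I * κ)) • w) ∈ A.graph := by
      refine mem_graph_of_inner_eq hA fun y v hy => ?_
      have h := (Submodule.mem_orthogonal' _ _).1 hw (L ⟨(y, v), hy⟩) ⟨_, rfl⟩
      rw [hL, inner_sub_right, inner_smul_right, sub_eq_zero] at h
      rw [inner_smul_left, h]
      simp
    have h0 := norm_le_of_graph hA κ hg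
    have h3 := graph_inner_im hA hg
    rw [inner_smul_right, inner_self_eq_norm_sq_to_K] at h3
    simpa [← Complex.ofReal_pow, hκ] using h3
  let e := ContinuousLinearEquiv.ofBijective L hker hrange
  refine ⟨(ContinuousLinearMap.fst ℂ E E ∘L A.graph.subtypeL) ∘L (e.symm : E →L[ℂ] A.graph),
    fun y => ?_⟩
  have hy : L (e.symm y) = y := e.apply_symm_apply y
  have h2 : y + (I * κ) • (e.symm y).1.1 = (e.symm y).1.2 := by
    rw [eq_comm, ← sub_eq_iff_eq_add, ← hL, hy]
  change ((e.symm y).1.1, y + (I * κ) • (e.symm y).1.1) ∈ A.graph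
  rw [h2]
  exact (e.symm y).2

theorem IsResolventAt.norm_apply_le (hA : IsSelfAdjoint A) {κ : ℝ} {R : E →L[ℂ] E}
    (hR : IsResolventAt A κ R) (y : E) : |κ| * ‖R y‖ ≤ ‖y‖ := by
  simpa using norm_le_of_graph hA κ (hR y)

theorem IsResolventAt.apply_sub (hA : IsSelfAdjoint A) {κ : ℝ} (hκ : κ ≠ 0) {R : E →L[ℂ] E}
    (hR : IsResolventAt A κ R) {x w : E} (hx : (x, w) ∈ A.graph) :
    R (w - (I * κ) • x) = x := by
  have h := norm_le_of_graph hA κ (A.graph.sub_mem (hR (w - (I * κ) • x)) hx)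
  have h0 : (w - (I * κ) • x + (I * κ) • R (w - (I * κ) • x)) - w
      - (I * κ) • (R (w - (I * κ) • x) - x) = 0 := by
    rw [smul_sub]; abel
  simp only at h
  rw [h0, norm_zero] at h
  have hκ' : 0 < |κ| := abs_pos.2 hκ
  have : ‖R (w - (I * κ) • x) - x‖ = 0 := by
    nlinarith [norm_nonneg (R (w - (I * κ) • x) - x)]
  exact sub_eq_zero.1 (norm_eq_zero.1 this)

/-- The first resolvent identity, written in both orders and divided by i(η - κ). -/
theorem IsResolventAt.mul_comm (hA : IsSelfAdjoint A) {κ η : ℝ} (hκ : κ ≠ 0) (hη : η ≠ 0)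
    {R S : E →L[ℂ] E} (hR : IsResolventAt A κ R) (hS : IsResolventAt A η S) :
    Commute R S := by
  have key : ∀ {κ η : ℝ} {R S : E →L[ℂ] E}, κ ≠ 0 → IsResolventAt A κ R → IsResolventAt A η S →
      ∀ x, S x = R x + (I * (η - κ)) • R (S x) := by
    intro κ η R S hκ hR hS x
    have h := hR.apply_sub hA hκ (hS x)
    have h2 : x + (I * η) • S x - (I * κ) • S x = x + (I * (η - κ)) • S x := by
      rw [mul_sub, sub_smul]; abel
    rw [h2, map_add, map_smul] at h
    exact h.symm
  by_cases hne : η = κ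
  · subst hne
    have : R = S := by
      ext x
      have := key hκ hR hS x
      simpa using this.symm
    rw [this]
  · ext x
    have h1 := key hκ hR hS x
    have h2 := key hη hS hR x
    have h3 : (I * ((η : ℂ) - κ)) • R (S x) = (I * (η - κ)) • S (R x) := by
      have e1 : (I * ((η : ℂ) - κ)) • R (S x) = S x - R x := by
        nth_rewrite 2 [h1]; abel
      have e2 : (I * ((κ : ℂ) - η)) • S (R x) = R x - S x := by
        nth_rewrite 2 [h2]; abel
      rw [e1, ← neg_sub (R x) (S x), ← e2, ← neg_smul]
      congr 1; ring
    have hc : I * ((η : ℂ) - κ) ≠ 0 :=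
      mul_ne_zero I_ne_zero (sub_ne_zero.2 (by exact_mod_cast hne))
    exact smul_right_injective E hc h3

theorem IsResolventAt.adjoint_eq (hA : IsSelfAdjoint A) {κ : ℝ}
    {R S : E →L[ℂ] E} (hR : IsResolventAt A κ R) (hS : IsResolventAt A (-κ) S) :
    star R = S := by
  rw [ContinuousLinearMap.star_eq_adjoint]
  symm
  rw [ContinuousLinearMap.eq_adjoint_iff]
  intro y x
  have h := graph_inner_eq hA (hS y) (hR x)
  rw [inner_add_left, inner_add_right, inner_smul_left, inner_smul_right] at h
  simp only [ofReal_neg, mul_neg, map_neg, map_mul, conj_I, conj_ofReal, neg_mul, neg_neg] at h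
  exact (add_right_cancel h).symm

/-! ### The bounded operator `(1 + A²)⁻¹` -/

/-- The witness is the factorisation (1 + A²)⁻¹ = (A - i)⁻¹(A + i)⁻¹. -/
theorem exists_isInvOneAddSq (hA : IsSelfAdjoint A) : ∃ S, IsInvOneAddSq A S := by
  obtain ⟨R, hR⟩ := exists_resolvent hA (one_ne_zero (α := ℝ))
  obtain ⟨T, hT⟩ := exists_resolvent hA (neg_ne_zero.2 (one_ne_zero (α := ℝ)))
  refine ⟨R * T, fun x => ⟨T x + I • R (T x), ?_, ?_⟩⟩
  · simpa using hR (T x)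
  · have h1 := hT x
    have h2 := A.graph.smul_mem I (hR (T x))
    have h := A.graph.add_mem h1 h2
    convert h using 1
    simp only [Prod.smul_mk, Prod.mk_add_mk, Prod.mk.injEq, true_and]
    simp [smul_smul, sub_eq_add_neg]

theorem isInvOneAddSq_invOneAddSq (hA : IsSelfAdjoint A) : IsInvOneAddSq A (invOneAddSq A) :=
  Classical.epsilon_spec (exists_isInvOneAddSq hA)

end SelfAdjoint

end Mourre

namespace Mourre

open Filter Topology Complex

/-! ### Construction of exp(itA) by Yosida approximation. -/

section Stone

variable {E : Type*} [NormedAddCommGroup E] [InnerProductSpace ℂ E] [CompleteSpace E]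
  {A : E →ₗ.[ℂ] E}

/-! ### Stone's theorem -/

/-- Bounded self-adjoint commuting (Yosida) approximants of a self-adjoint operator. -/
theorem exists_yosida (hA : IsSelfAdjoint A) : ∃ X : ℕ → E →L[ℂ] E, (∀ n, IsSelfAdjoint (X n)) ∧
    (∀ m n, Commute (X m) (X n)) ∧
    ∀ x w, (x, w) ∈ A.graph → Tendsto (fun n => X n x) atTop (𝓝 w) := by
  have hk : ∀ n : ℕ, ((n : ℝ) + 1) ≠ 0 := fun n => by positivity
  have hk' : ∀ n : ℕ, -((n : ℝ) + 1) ≠ 0 := fun n => neg_ne_zero.2 (hk n)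
  choose R hR using fun n : ℕ => exists_resolvent hA (hk n)
  choose T hT using fun n : ℕ => exists_resolvent hA (hk' n)
  have hRT : ∀ n, star (R n) = T n := fun n => (hR n).adjoint_eq hA (hT n)
  have hTR : ∀ n, star (T n) = R n := fun n => by rw [← hRT, star_star]
  -- the maps `κ / 2i (R - T)`, which tend strongly to the identity
  set J : ℕ → E →L[ℂ] E := fun n => (-(I * ((n : ℝ) + 1 : ℝ)) / 2) • (R n - T n) with hJ
  have hJnorm : ∀ n v, ‖J n v‖ ≤ ‖v‖ := by
    intro n v
    have h1 := (hR n).norm_apply_le hA v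
    have h2 := (hT n).norm_apply_le hA v
    rw [abs_neg] at h2
    have h3 : ‖J n v‖ = |(n : ℝ) + 1| / 2 * ‖R n v - T n v‖ := by
      simp only [hJ, smul_apply, sub_apply, norm_smul]
      rw [norm_div, norm_neg, norm_mul, norm_I, one_mul, Complex.norm_real, Real.norm_eq_abs]
      norm_num
    rw [h3]
    have h4 := norm_sub_le (R n v) (T n v)
    have h5 := mul_le_mul_of_nonneg_left h4 (abs_nonneg ((n : ℝ) + 1))
    linarith
  have hRv : ∀ n x w, (x, w) ∈ A.graph → R n w = x + (I * ((n : ℝ) + 1 : ℝ)) • R n x := by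
    intro n x w hx
    have := (hR n).apply_sub hA (hk n) hx
    rw [map_sub, map_smul, sub_eq_iff_eq_add] at this
    exact this
  have hTv : ∀ n x w, (x, w) ∈ A.graph → T n w = x - (I * ((n : ℝ) + 1 : ℝ)) • T n x := by
    intro n x w hx
    have := (hT n).apply_sub hA (hk' n) hx
    rw [map_sub, map_smul, sub_eq_iff_eq_add, ofReal_neg, mul_neg, neg_smul] at this
    rw [this, sub_eq_add_neg]
  have hJgraph : ∀ v u, (v, u) ∈ A.graph → ∀ n : ℕ, ‖J n v - v‖ ≤ ‖u‖ * (1 / ((n : ℝ) + 1)) := by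
    intro v u hv n
    have e : J n v - v = -((1 / 2 : ℂ) • (R n u + T n u)) := by
      simp only [hJ, smul_apply, sub_apply]
      rw [hRv n v u hv, hTv n v u hv]
      module
    have h1 := (hR n).norm_apply_le hA u
    have h2 := (hT n).norm_apply_le hA u
    have hp : 0 < (n : ℝ) + 1 := by positivity
    rw [abs_neg] at h2
    rw [abs_of_pos hp] at h1 h2
    rw [e, norm_neg, norm_smul, mul_one_div, le_div_iff₀ hp]
    have h3 := norm_add_le (R n u) (T n u)
    have h4 := mul_le_mul_of_nonneg_left h3 hp.le
    have h5 : ‖(1 / 2 : ℂ)‖ = 1 / 2 := by norm_num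
    rw [h5]
    linarith
  have hJtend : ∀ w, Tendsto (fun n => J n w) atTop (𝓝 w) := by
    intro w
    rw [Metric.tendsto_atTop]
    intro ε hε
    obtain ⟨v, hv, hvw⟩ := hA.dense_domain.exists_dist_lt w (ε := ε / 3) (by positivity)
    have hvg : (v, A ⟨v, hv⟩) ∈ A.graph := A.mem_graph ⟨v, hv⟩
    have hlim : Tendsto (fun n : ℕ => ‖A ⟨v, hv⟩‖ * (1 / ((n : ℝ) + 1))) atTop (𝓝 0) := by
      simpa using tendsto_one_div_add_atTop_nhds_zero_nat.const_mul ‖A ⟨v, hv⟩‖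
    obtain ⟨N, hN⟩ := eventually_atTop.1 (hlim.eventually (gt_mem_nhds (by positivity : 0 < ε / 3)))
    refine ⟨N, fun n hn => ?_⟩
    have h1 := (hJgraph v _ hvg n).trans_lt (hN n hn)
    have h2 := hJnorm n (w - v)
    rw [dist_eq_norm] at hvw ⊢
    have e : J n w - w = J n (w - v) + (J n v - v) - (w - v) := by rw [map_sub]; abel
    rw [e]
    have h3 := norm_sub_le (J n (w - v) + (J n v - v)) (w - v)
    have h4 := norm_add_le (J n (w - v)) (J n v - v)
    linarith
  -- With κ = n + 1 the approximant is κ²A(A² + κ²)⁻¹; on D(A) it equals `J n` applied to Ax, which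
  -- tends to Ax.
  refine ⟨fun n => ((((n : ℝ) + 1) ^ 2 / 2 : ℝ) : ℂ) • (R n + T n), fun n => ?_, fun m n => ?_,
    fun x w hx => ?_⟩
  · rw [isSelfAdjoint_iff, star_smul, star_add, hRT, hTR, add_comm (T n)]
    simp only [Complex.star_def, conj_ofReal]
  · refine Commute.smul_left (Commute.smul_right ?_ _) _
    exact ((IsResolventAt.mul_comm hA (hk m) (hk n) (hR m) (hR n)).add_right
      (IsResolventAt.mul_comm hA (hk m) (hk' n) (hR m) (hT n))).add_left
      ((IsResolventAt.mul_comm hA (hk' m) (hk n) (hT m) (hR n)).add_right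
      (IsResolventAt.mul_comm hA (hk' m) (hk' n) (hT m) (hT n)))
  · refine (hJtend w).congr fun n => ?_
    simp only [hJ, smul_apply, sub_apply,
      add_apply]
    rw [hRv n x w hx, hTv n x w hx]
    have : (((((n : ℝ) + 1) ^ 2 / 2 : ℝ)) : ℂ)
        = -(I * ((n : ℝ) + 1 : ℝ)) / 2 * (I * ((n : ℝ) + 1 : ℝ)) := by
      push_cast
      linear_combination (((n : ℂ) + 1) ^ 2 / 2) * I_sq
    rw [this]
    module

/-- The unitary group `t ↦ exp (itX)` of a bounded operator `X`. -/
noncomputable def boundedExp (X : E →L[ℂ] E) (t : ℝ) : E →L[ℂ] E :=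
  NormedSpace.exp ((t : ℂ) • (I • X))

theorem boundedExp_mem_unitary {X : E →L[ℂ] E} (hX : IsSelfAdjoint X) (t : ℝ) :
    boundedExp X t ∈ unitary (E →L[ℂ] E) := by
  let _ : NormedAlgebra ℚ (E →L[ℂ] E) := .restrictScalars ℚ ℂ _
  refine NormedSpace.exp_mem_unitary_of_mem_skewAdjoint ?_
  rw [skewAdjoint.mem_iff, star_smul, star_smul, hX.star_eq]
  simp

theorem boundedExp_zero (X : E →L[ℂ] E) : boundedExp X 0 = 1 := by
  simp [boundedExp]

theorem boundedExp_add (X : E →L[ℂ] E) (s t : ℝ) :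
    boundedExp X (s + t) = boundedExp X s * boundedExp X t := by
  let _ : NormedAlgebra ℚ (E →L[ℂ] E) := .restrictScalars ℚ ℂ _
  rw [boundedExp, ofReal_add, add_smul, NormedSpace.exp_add_of_commute]
  · rfl
  · exact ((Commute.refl _).smul_left _).smul_right _

theorem hasDerivAt_boundedExp (X : E →L[ℂ] E) (t : ℝ) :
    HasDerivAt (boundedExp X) (boundedExp X t * (I • X)) t := by
  have h := HasDerivAt.scomp t (hasDerivAt_exp_smul_const (𝕂 := ℂ) (I • X) (t : ℂ))
    Complex.ofRealCLM.hasDerivAt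
  rw [ofRealCLM_apply, ofReal_one, one_smul] at h
  exact h

theorem norm_unitary_apply {U : E →L[ℂ] E} (hU : U ∈ unitary (E →L[ℂ] E)) (x : E) :
    ‖U x‖ = ‖x‖ :=
  (ContinuousLinearMap.norm_map_iff_adjoint_comp_self U).2 (Unitary.star_mul_self_of_mem hU) x

omit [CompleteSpace E] in
theorem hasDerivAt_apply_const {U : ℝ → E →L[ℂ] E} {U' : E →L[ℂ] E} {t : ℝ}
    (h : HasDerivAt U U' t) (x : E) : HasDerivAt (fun s => U s x) (U' x) t :=
  ((ContinuousLinearMap.apply ℂ E x).restrictScalars ℝ).hasFDerivAt.comp_hasDerivAt t h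

theorem norm_boundedExp_apply_sub_self_le {X : E →L[ℂ] E} (hX : IsSelfAdjoint X) (t : ℝ) (x : E) :
    ‖boundedExp X t x - x‖ ≤ ‖X x‖ * |t| := by
  have h := Convex.norm_image_sub_le_of_norm_hasDerivWithin_le (f := fun s => boundedExp X s x)
    (f' := fun s => (boundedExp X s * (I • X)) x) (s := Set.univ) (x := 0) (y := t) (C := ‖X x‖)
    (fun s _ => (hasDerivAt_apply_const (hasDerivAt_boundedExp X s) x).hasDerivWithinAt)
    (fun s _ => ?_) convex_univ trivial trivial
  · simpa [boundedExp_zero] using h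
  · rw [mul_apply_eq_comp, norm_unitary_apply (boundedExp_mem_unitary hX s)]
    simp [norm_smul]

/-- For commuting X and Y, exp(itX) = exp(itY) exp(it(X - Y)) with a unitary first factor.
Convergence of the approximants on D(A) thus controls the groups uniformly for bounded times. -/
theorem norm_boundedExp_sub_apply_le {X Y : E →L[ℂ] E} (hX : IsSelfAdjoint X)
    (hY : IsSelfAdjoint Y) (hXY : Commute X Y) (t : ℝ) (x : E) :
    ‖boundedExp X t x - boundedExp Y t x‖ ≤ ‖X x - Y x‖ * |t| := by
  let _ : NormedAlgebra ℚ (E →L[ℂ] E) := .restrictScalars ℚ ℂ _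
  have e : boundedExp X t = boundedExp Y t * boundedExp (X - Y) t := by
    simp only [boundedExp]
    rw [← NormedSpace.exp_add_of_commute]
    · congr 1; module
    · have : Commute Y (X - Y) := hXY.symm.sub_right (Commute.refl Y)
      exact (((this.smul_left _).smul_right _).smul_left _).smul_right _
  have h := norm_boundedExp_apply_sub_self_le (hX.sub hY) t x
  rw [e, mul_apply_eq_comp, ← map_sub,
    norm_unitary_apply (boundedExp_mem_unitary hY t)]
  exact h

/-- **Stone's theorem**: a self-adjoint operator generates a strongly continuous unitary group. -/
theorem exists_isUnitaryGroupOf (hA : IsSelfAdjoint A) :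
    ∃ U : ℝ → E →L[ℂ] E, IsUnitaryGroupOf A U := by
  obtain ⟨X, hX, hcomm, hlim⟩ := exists_yosida hA
  have hiso : ∀ n t x, ‖boundedExp (X n) t x‖ = ‖x‖ := fun n t x =>
    norm_unitary_apply (boundedExp_mem_unitary (hX n) t) x
  -- the approximating groups are Cauchy, uniformly for bounded times
  have hcauchy : ∀ (x : E) (r : ℝ), 0 < r →
      UniformCauchySeqOn (fun n t => boundedExp (X n) t x) atTop (Metric.ball 0 r) := by
    intro x r hr
    rw [Metric.uniformCauchySeqOn_iff]
    intro ε hε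
    obtain ⟨v, hv, hvx⟩ := hA.dense_domain.exists_dist_lt x (ε := ε / 3) (by positivity)
    have hc := (hlim v _ (A.mem_graph ⟨v, hv⟩)).cauchySeq
    obtain ⟨N, hN⟩ := Metric.cauchySeq_iff.1 hc (ε / (3 * r)) (by positivity)
    refine ⟨N, fun m hm n hn t ht => ?_⟩
    have h1 := norm_boundedExp_sub_apply_le (hX m) (hX n) (hcomm m n) t v
    have h2 := hN m hm n hn
    rw [dist_eq_norm] at h2 hvx ⊢
    rw [mem_ball_zero_iff, Real.norm_eq_abs] at ht
    have h3 : ‖X m v - X n v‖ * |t| ≤ ε / 3 := by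
      calc ‖X m v - X n v‖ * |t| ≤ ε / (3 * r) * r :=
            mul_le_mul h2.le ht.le (abs_nonneg _) (by positivity)
        _ = ε / 3 := by field_simp
    have e : boundedExp (X m) t x - boundedExp (X n) t x
        = boundedExp (X m) t (x - v) + (boundedExp (X m) t v - boundedExp (X n) t v)
          - boundedExp (X n) t (x - v) := by
      rw [map_sub, map_sub]; abel
    rw [e]
    have h4 := norm_sub_le (boundedExp (X m) t (x - v)
      + (boundedExp (X m) t v - boundedExp (X n) t v)) (boundedExp (X n) t (x - v))
    have h5 := norm_add_le (boundedExp (X m) t (x - v))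
      (boundedExp (X m) t v - boundedExp (X n) t v)
    rw [hiso] at h4 h5
    linarith
  have hball : ∀ t : ℝ, t ∈ Metric.ball (0 : ℝ) (|t| + 1) := fun t => by
    rw [mem_ball_zero_iff, Real.norm_eq_abs]; linarith
  have hex : ∀ t x, ∃ y, Tendsto (fun n => boundedExp (X n) t x) atTop (𝓝 y) := fun t x =>
    cauchySeq_tendsto_of_complete
      ((hcauchy x (|t| + 1) (by positivity)).cauchySeq (hball t))
  choose u hu using hex
  let U : ℝ → E →L[ℂ] E := fun t =>
    continuousLinearMapOfTendsto (fun n => boundedExp (X n) t) (tendsto_pi_nhds.2 (hu t))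
  have hU : ∀ t x, Tendsto (fun n => boundedExp (X n) t x) atTop (𝓝 (U t x)) := hu
  have hunif : ∀ (x : E) (r : ℝ), 0 < r →
      TendstoUniformlyOn (fun n t => boundedExp (X n) t x) (fun t => U t x) atTop
        (Metric.ball 0 r) := fun x r hr =>
    (hcauchy x r hr).tendstoUniformlyOn_of_tendsto fun t _ => hU t x
  have hnorm : ∀ t x, ‖U t x‖ = ‖x‖ := fun t x =>
    tendsto_nhds_unique ((hU t x).norm) (by simp only [hiso]; exact tendsto_const_nhds)
  have hzero : U 0 = 1 := by
    ext x
    refine tendsto_nhds_unique (hU 0 x) ?_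
    simp only [boundedExp_zero]
    exact tendsto_const_nhds
  have hadd : ∀ s t, U (s + t) = U s * U t := by
    intro s t
    ext x
    refine tendsto_nhds_unique (hU (s + t) x) ?_
    rw [mul_apply_eq_comp, tendsto_iff_norm_sub_tendsto_zero]
    have h1 := tendsto_iff_norm_sub_tendsto_zero.1 (hU t x)
    have h2 := tendsto_iff_norm_sub_tendsto_zero.1 (hU s (U t x))
    refine squeeze_zero (fun _ => norm_nonneg _) (fun n => ?_) (by simpa using h1.add h2)
    rw [boundedExp_add, mul_apply_eq_comp, ← hiso n s (boundedExp (X n) t x - U t x),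
      map_sub]
    exact norm_sub_le_norm_sub_add_norm_sub _ _ _
  -- The strong limit of unitaries is a priori only isometric; the group law supplies inverses and
  -- hence unitarity.
  have hinv : ∀ t, U (-t) * U t = 1 := fun t => by rw [← hadd, neg_add_cancel, hzero]
  have hinv' : ∀ t, U t * U (-t) = 1 := fun t => by rw [← hadd, add_neg_cancel, hzero]
  have hstar : ∀ t, star (U t) * U t = 1 := fun t =>
    (ContinuousLinearMap.norm_map_iff_adjoint_comp_self (U t)).1 (hnorm t)
  have hstar' : ∀ t, star (U t) = U (-t) := fun t => by
    rw [← mul_one (star (U t)), ← hinv' t, ← mul_assoc, hstar, one_mul]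
  have hcont : ∀ x, Continuous fun t => U t x := by
    intro x
    rw [continuous_iff_continuousAt]
    intro t
    have h := (hunif x (|t| + 1) (by positivity)).continuousOn (Frequently.of_forall fun n =>
      (continuous_iff_continuousAt.2 fun s =>
        (hasDerivAt_apply_const (hasDerivAt_boundedExp (X n) s) x).continuousAt).continuousOn)
    exact h.continuousAt (Metric.isOpen_ball.mem_nhds (hball t))
  have hderiv : ∀ x w, (x, w) ∈ A.graph → HasDerivAt (fun t => U t x) (I • w) 0 := by
    intro x w hx
    -- For x in D(A) the derivatives exp(itXₙ)(iXₙx) converge uniformly near 0 to U(t)(iAx), so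
    -- limit and derivative can be exchanged.
    have h := hasDerivAt_of_tendstoUniformlyOn (l := atTop)
      (f := fun n t => boundedExp (X n) t x)
      (f' := fun n t => (boundedExp (X n) t * (I • X n)) x)
      (g := fun t => U t x) (g' := fun t => U t (I • w)) (x := 0)
      (Metric.isOpen_ball (x := (0 : ℝ)) (ε := 1)) ?_
      (Eventually.of_forall fun n t _ => hasDerivAt_apply_const (hasDerivAt_boundedExp (X n) t) x)
      (fun t _ => hU t x) (Metric.mem_ball_self one_pos)
    · simpa [hzero] using h
    · rw [Metric.tendstoUniformlyOn_iff]
      intro ε hε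
      have h1 := Metric.tendstoUniformlyOn_iff.1 (hunif (I • w) 1 one_pos) (ε / 2) (by positivity)
      have h2 := Metric.tendsto_nhds.1 ((hlim x w hx).const_smul I) (ε / 2) (by positivity)
      filter_upwards [h1, h2] with n h1 h2 t ht
      have h3 := h1 t ht
      have h4 : dist (boundedExp (X n) t (I • w)) (boundedExp (X n) t (I • X n x)) < ε / 2 := by
        rw [dist_eq_norm, ← map_sub, hiso, ← dist_eq_norm, dist_comm]
        exact h2
      calc _ ≤ _ := dist_triangle _ (boundedExp (X n) t (I • w)) _
        _ < ε / 2 + ε / 2 := add_lt_add h3 h4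
        _ = ε := by ring
  refine ⟨U, fun t => ⟨hstar t, by rw [hstar', hinv']⟩, hzero, hadd, hcont,
    fun x y => ⟨hderiv x y, fun h => ?_⟩⟩
  -- The generator is no larger than A: differentiating ⟪w, U(t)x⟫ = ⟪U(-t)w, x⟫ for w in D(A) puts
  -- x into D(A*) = D(A).
  refine mem_graph_of_inner_eq hA fun w v hw => ?_
  have h1 : HasDerivAt (fun t => ⟪w, U t x⟫_ℂ) (⟪w, I • y⟫_ℂ) 0 := by
    simpa only [inner_zero_left, add_zero] using (hasDerivAt_const (0 : ℝ) w).inner ℂ h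
  have h2 : HasDerivAt (fun t => ⟪U (-t) w, x⟫_ℂ) (⟪-(I • v), x⟫_ℂ) 0 := by
    have h3 : HasDerivAt (fun t => U (-t) w) (-(I • v)) 0 := by
      have := HasDerivAt.scomp (0 : ℝ) (g₁ := fun t => U t w) (g₁' := I • v)
        (by simpa using hderiv w v hw) (hasDerivAt_neg (0 : ℝ))
      simpa [Function.comp_def] using this
    simpa using h3.inner ℂ (hasDerivAt_const (0 : ℝ) x)
  have e : (fun t => ⟪U (-t) w, x⟫_ℂ) = fun t => ⟪w, U t x⟫_ℂ := by
    ext t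
    rw [← hstar' t, ContinuousLinearMap.star_eq_adjoint, ContinuousLinearMap.adjoint_inner_left]
  rw [e] at h2
  have h3 := h1.unique h2
  rw [inner_smul_right, inner_neg_left, inner_smul_left, conj_I, neg_mul, neg_neg] at h3
  have h4 := mul_left_cancel₀ I_ne_zero h3
  rw [← inner_conj_symm, h4, inner_conj_symm]

theorem isUnitaryGroupOf_expI (hA : IsSelfAdjoint A) : IsUnitaryGroupOf A (expI A) :=
  Classical.epsilon_spec (exists_isUnitaryGroupOf hA)

end Stone

end Mourre

namespace Mourre

open Filter Topology Complex

/-! ### Commutators as strong derivatives of conjugated operators. -/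

section Commutators

variable {E : Type*} [NormedAddCommGroup E] [InnerProductSpace ℂ E] [CompleteSpace E]
  {A : E →ₗ.[ℂ] E}

/-! ### Strong derivatives along the unitary group -/

-- A product rule at a zero of f: `V` only has to be uniformly bounded and strongly continuous at 0,
-- not differentiable. This is what makes the rules for products and inverses work in the strong
-- topology.
omit [CompleteSpace E] in
theorem hasDerivAt_apply_of_bounded {V : ℝ → E →L[ℂ] E} {M : ℝ} (hM : ∀ t x, ‖V t x‖ ≤ M * ‖x‖)
    (hV : ∀ x, ContinuousAt (fun t => V t x) 0) {f : ℝ → E} {f' : E} (hf0 : f 0 = 0)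
    (hf : HasDerivAt f f' 0) : HasDerivAt (fun t => V t (f t)) (V 0 f') 0 := by
  have hM0 : 0 ≤ |M| := abs_nonneg M
  rw [hasDerivAt_iff_isLittleO_nhds_zero] at hf ⊢
  simp only [zero_add, hf0, map_zero, sub_zero] at hf ⊢
  have h1 : (fun t => V t (f t - t • f')) =o[𝓝 0] fun t : ℝ => t := by
    refine Asymptotics.IsBigO.trans_isLittleO ?_ hf
    exact Asymptotics.IsBigO.of_bound M (Eventually.of_forall fun t => hM t _)
  have h2 : (fun t => t • (V t f' - V 0 f')) =o[𝓝 0] fun t : ℝ => t := by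
    have h3 : (fun t => V t f' - V 0 f') =o[𝓝 0] fun _ : ℝ => (1 : ℝ) := by
      rw [Asymptotics.isLittleO_one_iff]
      simpa using (hV f').sub_const (V 0 f')
    simpa using (Asymptotics.isBigO_refl (fun t : ℝ => t) (𝓝 0)).smul_isLittleO h3
  refine (h1.add h2).congr_left fun t => ?_
  have : V t (t • f') = t • V t f' := (V t).map_smul_of_tower t f'
  rw [map_sub, this, smul_sub]
  abel

/-- The conjugated operator `exp(itA) T exp(-itA)`. -/
noncomputable def conjugate (A : E →ₗ.[ℂ] E) (T : E →L[ℂ] E) (t : ℝ) : E →L[ℂ] E :=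
  expI A t * T * expI A (-t)

/-- `D` is the strong derivative at `t = 0` of `t ↦ exp(itA) T exp(-itA)`. -/
def HasConjugateDeriv (A : E →ₗ.[ℂ] E) (T D : E →L[ℂ] E) : Prop :=
  ∀ x, HasDerivAt (fun t => conjugate A T t x) (D x) 0

theorem conjugate_apply (T : E →L[ℂ] E) (t : ℝ) (x : E) :
    conjugate A T t x = expI A t (T (expI A (-t) x)) := rfl

theorem norm_expI_apply (hA : IsSelfAdjoint A) (t : ℝ) (x : E) : ‖expI A t x‖ = ‖x‖ :=
  norm_unitary_apply ((isUnitaryGroupOf_expI hA).unitary t) x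

theorem expI_neg_mul (hA : IsSelfAdjoint A) (t : ℝ) : expI A (-t) * expI A t = 1 := by
  rw [← (isUnitaryGroupOf_expI hA).add, neg_add_cancel, (isUnitaryGroupOf_expI hA).zero]

theorem expI_mul_neg (hA : IsSelfAdjoint A) (t : ℝ) : expI A t * expI A (-t) = 1 := by
  rw [← (isUnitaryGroupOf_expI hA).add, add_neg_cancel, (isUnitaryGroupOf_expI hA).zero]

theorem star_expI (hA : IsSelfAdjoint A) (t : ℝ) : star (expI A t) = expI A (-t) := by
  have h := Unitary.star_mul_self_of_mem ((isUnitaryGroupOf_expI hA).unitary t)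
  rw [← mul_one (star (expI A t)), ← expI_mul_neg hA t, ← mul_assoc, h, one_mul]

theorem inner_expI_apply (hA : IsSelfAdjoint A) (t : ℝ) (x y : E) :
    ⟪x, expI A t y⟫_ℂ = ⟪expI A (-t) x, y⟫_ℂ := by
  rw [← star_expI hA, ContinuousLinearMap.star_eq_adjoint, ContinuousLinearMap.adjoint_inner_left]

theorem conjugate_zero (hA : IsSelfAdjoint A) (T : E →L[ℂ] E) : conjugate A T 0 = T := by
  simp [conjugate, (isUnitaryGroupOf_expI hA).zero]

theorem conjugate_mul (hA : IsSelfAdjoint A) (T S : E →L[ℂ] E) (t : ℝ) :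
    conjugate A (T * S) t = conjugate A T t * conjugate A S t := by
  calc _ = expI A t * T * 1 * S * expI A (-t) := by simp only [conjugate, mul_one, mul_assoc]
    _ = _ := by rw [← expI_neg_mul hA t, conjugate, conjugate]; simp only [mul_assoc]

theorem norm_conjugate_apply_le (hA : IsSelfAdjoint A) (T : E →L[ℂ] E) (t : ℝ) (x : E) :
    ‖conjugate A T t x‖ ≤ ‖T‖ * ‖x‖ := by
  rw [conjugate_apply, norm_expI_apply hA, ← norm_expI_apply hA (-t) x]
  exact T.le_opNorm _

theorem continuousAt_conjugate_apply (hA : IsSelfAdjoint A) (T : E →L[ℂ] E) (x : E) :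
    ContinuousAt (fun t => conjugate A T t x) 0 := by
  have hU := isUnitaryGroupOf_expI hA
  have h1 : Tendsto (fun t => ‖expI A (-t) x - x‖) (𝓝 0) (𝓝 0) := by
    have := (((hU.strongly_continuous x).comp continuous_neg).sub
      (continuous_const (y := x))).norm.tendsto 0
    simpa [hU.zero] using this
  have h2 : Tendsto (fun t => ‖expI A t (T x) - T x‖) (𝓝 0) (𝓝 0) := by
    have := ((hU.strongly_continuous (T x)).sub (continuous_const (y := T x))).norm.tendsto 0
    simpa [hU.zero] using this
  rw [ContinuousAt, conjugate_zero hA, tendsto_iff_norm_sub_tendsto_zero]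
  refine squeeze_zero (fun _ => norm_nonneg _) (fun t => ?_)
    (by simpa using (h1.const_mul ‖T‖).add h2)
  calc ‖conjugate A T t x - T x‖
      = ‖expI A t (T (expI A (-t) x - x)) + (expI A t (T x) - T x)‖ := by
        rw [conjugate_apply, map_sub, map_sub]; congr 1; abel
    _ ≤ ‖expI A t (T (expI A (-t) x - x))‖ + ‖expI A t (T x) - T x‖ := norm_add_le _ _
    _ ≤ _ := by
        rw [norm_expI_apply hA]
        gcongr
        exact T.le_opNorm _

theorem HasConjugateDeriv.unique {T D D' : E →L[ℂ] E} (h : HasConjugateDeriv A T D)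
    (h' : HasConjugateDeriv A T D') : D = D' :=
  ContinuousLinearMap.ext fun x => (h x).unique (h' x)

/-- The group law transports the derivative at 0 to every t. Second derivatives and the virial
argument below depend on this. -/
theorem HasConjugateDeriv.hasDerivAt (hA : IsSelfAdjoint A) {T D : E →L[ℂ] E}
    (h : HasConjugateDeriv A T D) (t : ℝ) (x : E) :
    HasDerivAt (fun s => conjugate A T s x) (conjugate A D t x) t := by
  have hU := isUnitaryGroupOf_expI hA
  have h1 : HasDerivAt (fun s => conjugate A T (s - t) (expI A (-t) x)) (D (expI A (-t) x)) t :=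
    HasDerivAt.comp_sub_const t t (by simpa using h (expI A (-t) x))
  have h2 := (((expI A t).restrictScalars ℝ).hasFDerivAt).comp_hasDerivAt t h1
  refine h2.congr_of_eventuallyEq (Eventually.of_forall fun s => ?_)
  have e1 : expI A s = expI A t * expI A (s - t) := by rw [← hU.add]; congr 1; ring
  have e2 : expI A (-s) = expI A (-(s - t)) * expI A (-t) := by rw [← hU.add]; congr 1; ring
  simp only [conjugate_apply, Function.comp_apply, ContinuousLinearMap.coe_restrictScalars']
  rw [e1, e2]
  rfl

theorem HasConjugateDeriv.one (hA : IsSelfAdjoint A) : HasConjugateDeriv A 1 0 := by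
  intro x
  have : ∀ t, conjugate A 1 t x = x := fun t => by
    rw [conjugate, mul_one, expI_mul_neg hA]; rfl
  simp only [this]
  exact hasDerivAt_const _ _

theorem HasConjugateDeriv.add {T D T' D' : E →L[ℂ] E} (h : HasConjugateDeriv A T D)
    (h' : HasConjugateDeriv A T' D') : HasConjugateDeriv A (T + T') (D + D') := by
  intro x
  refine ((h x).add (h' x)).congr_of_eventuallyEq (Eventually.of_forall fun t => ?_)
  simp [conjugate_apply]

theorem HasConjugateDeriv.smul {T D : E →L[ℂ] E} (h : HasConjugateDeriv A T D) (c : ℂ) :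
    HasConjugateDeriv A (c • T) (c • D) := by
  intro x
  refine ((h x).const_smul c).congr_of_eventuallyEq (Eventually.of_forall fun t => ?_)
  simp [conjugate_apply]

theorem HasConjugateDeriv.mul (hA : IsSelfAdjoint A) {T D T' D' : E →L[ℂ] E}
    (h : HasConjugateDeriv A T D) (h' : HasConjugateDeriv A T' D') :
    HasConjugateDeriv A (T * T') (D * T' + T * D') := by
  intro x
  have h1 := hasDerivAt_apply_of_bounded (norm_conjugate_apply_le hA T)
    (continuousAt_conjugate_apply hA T) (f := fun t => conjugate A T' t x - T' x)
    (by simp [conjugate_zero hA]) ((h' x).sub_const (T' x))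
  refine ((h (T' x)).add h1).congr_of_eventuallyEq (Eventually.of_forall fun t => ?_) |>.congr_deriv
    (by rw [conjugate_zero hA]; rfl)
  rw [conjugate_mul hA]
  simp

/-- Writing G(t), T(t) for the conjugated operators, G(t)x = Gx - G(t)(T(t) - T)Gx. Only strong
continuity of G(t) enters, so differentiability of the inverse is a conclusion. -/
theorem HasConjugateDeriv.inverse (hA : IsSelfAdjoint A) {T D G : E →L[ℂ] E}
    (h : HasConjugateDeriv A T D) (hTG : T * G = 1) (hGT : G * T = 1) :
    HasConjugateDeriv A G (-(G * D * G)) := by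
  intro x
  have hx : T (G x) = x := congrArg (fun S : E →L[ℂ] E => S x) hTG
  have h1 := hasDerivAt_apply_of_bounded (norm_conjugate_apply_le hA G)
    (continuousAt_conjugate_apply hA G) (f := fun t => conjugate A T t (G x) - T (G x))
    (by simp [conjugate_zero hA]) ((h (G x)).sub_const (T (G x)))
  refine (h1.const_sub (G x)).congr_of_eventuallyEq (Eventually.of_forall fun t => ?_)
    |>.congr_deriv (by rw [conjugate_zero hA]; rfl)
  have h2 : conjugate A G t (conjugate A T t (G x)) = G x := by
    have := congrArg (fun S : E →L[ℂ] E => S (G x)) (conjugate_mul hA G T t)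
    rw [hGT] at this
    refine this.symm.trans ?_
    rw [conjugate, mul_one, expI_mul_neg hA]; rfl
  simp only [map_sub, h2, hx]
  abel

/-- Pointwise derivatives are limits of difference quotients along 1/(n + 1); by Banach–Steinhaus
the limit operator is bounded. -/
theorem exists_hasConjugateDeriv (hA : IsSelfAdjoint A) {T : E →L[ℂ] E}
    (h : ∀ x, DifferentiableAt ℝ (fun t => conjugate A T t x) 0) :
    ∃ D, HasConjugateDeriv A T D := by
  have hlim : ∀ x, Tendsto (fun n : ℕ =>
      (((n : ℂ) + 1) • (conjugate A T (1 / ((n : ℝ) + 1)) - T)) x) atTop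
      (𝓝 (deriv (fun t => conjugate A T t x) 0)) := by
    intro x
    have h1 := (hasDerivAt_iff_tendsto_slope.1 (h x).hasDerivAt)
    have h2 : Tendsto (fun n : ℕ => 1 / ((n : ℝ) + 1)) atTop (𝓝[≠] 0) :=
      tendsto_nhdsWithin_iff.2 ⟨tendsto_one_div_add_atTop_nhds_zero_nat,
        Eventually.of_forall fun n => by
          simp only [Set.mem_compl_iff, Set.mem_singleton_iff]; positivity⟩
    refine (h1.comp h2).congr fun n => ?_
    simp only [Function.comp_apply, slope, sub_zero, one_div, inv_inv, vsub_eq_sub, smul_apply,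
      sub_apply, conjugate_zero hA]
    rw [← Complex.coe_smul]
    push_cast
    rfl
  exact ⟨continuousLinearMapOfTendsto _ (tendsto_pi_nhds.2 hlim), fun x => (h x).hasDerivAt⟩

theorem HasConjugateDeriv.isSelfAdjoint (hA : IsSelfAdjoint A) {T D : E →L[ℂ] E}
    (hT : IsSelfAdjoint T) (h : HasConjugateDeriv A T D) : IsSelfAdjoint D := by
  rw [ContinuousLinearMap.isSelfAdjoint_iff_isSymmetric] at hT ⊢
  intro x y
  have h1 : HasDerivAt (fun t => ⟪conjugate A T t x, y⟫_ℂ) (⟪D x, y⟫_ℂ) 0 := by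
    simpa only [inner_zero_right, zero_add] using (h x).inner ℂ (hasDerivAt_const (0 : ℝ) y)
  have h2 : HasDerivAt (fun t => ⟪x, conjugate A T t y⟫_ℂ) (⟪x, D y⟫_ℂ) 0 := by
    simpa only [inner_zero_left, add_zero] using (hasDerivAt_const (0 : ℝ) x).inner ℂ (h y)
  have e : (fun t => ⟪conjugate A T t x, y⟫_ℂ) = fun t => ⟪x, conjugate A T t y⟫_ℂ := by
    ext t
    rw [conjugate_apply, conjugate_apply, inner_expI_apply hA, ← inner_conj_symm,
      inner_expI_apply hA, inner_conj_symm]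
    exact hT _ _
  rw [e] at h1
  exact h1.unique h2

/-- The link with the formal commutator: D is i(AT - TA) as a form on D(A). -/
theorem HasConjugateDeriv.inner_eq (hA : IsSelfAdjoint A) {T D : E →L[ℂ] E}
    (h : HasConjugateDeriv A T D) {φ φ' ψ ψ' : E} (hφ : (φ, φ') ∈ A.graph)
    (hψ : (ψ, ψ') ∈ A.graph) :
    ⟪φ, D ψ⟫_ℂ = I * (⟪φ', T ψ⟫_ℂ - ⟪φ, T ψ'⟫_ℂ) := by
  have hU := isUnitaryGroupOf_expI hA
  have hneg : ∀ {x w : E}, (x, w) ∈ A.graph →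
      HasDerivAt (fun t => expI A (-t) x) (-(I • w)) 0 := by
    intro x w hx
    have := HasDerivAt.scomp (0 : ℝ) (g₁ := fun t => expI A t x) (g₁' := I • w)
      (by simpa using (hU.generator x w).1 hx) (hasDerivAt_neg (0 : ℝ))
    simpa [Function.comp_def] using this
  have h1 : HasDerivAt (fun t => ⟪φ, conjugate A T t ψ⟫_ℂ) (⟪φ, D ψ⟫_ℂ) 0 := by
    simpa only [inner_zero_left, add_zero] using (hasDerivAt_const (0 : ℝ) φ).inner ℂ (h ψ)
  have h2 := (hneg hφ).inner ℂ
    ((T.restrictScalars ℝ).hasFDerivAt.comp_hasDerivAt (0 : ℝ) (hneg hψ))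
  have e : (fun t => ⟪φ, conjugate A T t ψ⟫_ℂ)
      = fun t => ⟪expI A (-t) φ, T (expI A (-t) ψ)⟫_ℂ := by
    ext t
    rw [conjugate_apply, inner_expI_apply hA]
  rw [e] at h1
  rw [h1.unique h2]
  simp only [neg_zero, hU.zero, ContinuousLinearMap.coe_restrictScalars', Function.comp_apply,
    one_apply_eq_self, map_neg, map_smul, inner_neg_right, inner_neg_left,
    inner_smul_left, inner_smul_right, conj_I]
  ring

/-- A bounded T cannot have a strictly positive commutator on the whole space: the expectation of
its conjugates at a unit vector would decrease at rate at least a for all times, although it stays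
in [-‖T‖, ‖T‖]. -/
theorem HasConjugateDeriv.exists_re_inner_lt (hA : IsSelfAdjoint A) [Nontrivial E]
    {T D : E →L[ℂ] E} (h : HasConjugateDeriv A T D) {a : ℝ} (ha : 0 < a) :
    ∃ x, (⟪x, -D x⟫_ℂ).re < a * ‖x‖ ^ 2 := by
  by_contra! hc
  obtain ⟨x, hx⟩ := exists_norm_eq E (zero_le_one (α := ℝ))
  have hd : ∀ t, HasDerivAt (fun t => (⟪x, conjugate A T t x⟫_ℂ).re)
      ((⟪x, conjugate A D t x⟫_ℂ).re) t := fun t => by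
    have h1 := (hasDerivAt_const t x).inner ℂ (h.hasDerivAt hA t x)
    simp only [inner_zero_left, add_zero] at h1
    exact Complex.reCLM.hasFDerivAt.comp_hasDerivAt t h1
  have hle : ∀ t, (⟪x, conjugate A D t x⟫_ℂ).re ≤ -a := fun t => by
    have h1 := hc (expI A (-t) x)
    rw [norm_expI_apply hA, hx, inner_neg_right, Complex.neg_re] at h1
    rw [conjugate_apply, inner_expI_apply hA]
    linarith
  have hb : ∀ t, |(⟪x, conjugate A T t x⟫_ℂ).re| ≤ ‖T‖ := fun t => by
    have h1 := (Complex.abs_re_le_norm _).trans (norm_inner_le_norm (𝕜 := ℂ) x (conjugate A T t x))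
    have h2 := norm_conjugate_apply_le hA T t x
    rw [hx] at h1 h2
    linarith
  -- At this time the line ‖T‖ - at has reached -‖T‖ - 1, below the admissible range.
  have hpos : 0 < (2 * ‖T‖ + 1) / a := by positivity
  have h1 := image_le_of_deriv_right_le_deriv_boundary
    (f := fun t => (⟪x, conjugate A T t x⟫_ℂ).re) (a := 0) (b := (2 * ‖T‖ + 1) / a)
    (fun t _ => (hd t).continuousAt.continuousWithinAt) (fun t _ => (hd t).hasDerivWithinAt)
    (B := fun t => ‖T‖ - a * t) (B' := fun _ => -a) ?_
    (fun t _ => by fun_prop)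
    (fun t _ => by
      simpa using (((hasDerivAt_id t).const_mul a).const_sub ‖T‖).hasDerivWithinAt)
    (fun t _ => hle t) (Set.right_mem_Icc.2 hpos.le)
  · have h2 := (abs_le.1 (hb ((2 * ‖T‖ + 1) / a))).1
    rw [mul_div_cancel₀ _ ha.ne'] at h1
    linarith
  · simpa using (abs_le.1 (hb 0)).2

/-! ### Operators of class `C²` -/

theorem isCommutator_iff {T C : E →L[ℂ] E} :
    IsCommutator A T C ↔ HasConjugateDeriv A T (-(I • C)) := by
  constructor
  · intro h x
    refine (((h x).const_smul (-I)).congr_of_eventuallyEq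
      (Eventually.of_forall fun t => ?_)).congr_deriv (by simp)
    simp [conjugate_apply, smul_smul]
  · intro h x
    exact ((h x).const_smul I).congr_deriv (by simp [smul_smul])

theorem isCommutator_of_hasConjugateDeriv {T D : E →L[ℂ] E} (h : HasConjugateDeriv A T D) :
    IsCommutator A T (commutator T A) :=
  Classical.epsilon_spec (p := IsCommutator A T)
    ⟨I • D, isCommutator_iff.2 (by simpa [smul_smul] using h)⟩

theorem IsOfClass.isCommutator (hA : IsSelfAdjoint A) {H : E →L[ℂ] E} (hH : IsOfClass A 2 H) :
    IsCommutator A H (commutator H A) ∧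
      IsCommutator A (commutator H A) (commutator (commutator H A) A) := by
  obtain ⟨-, z, hz, hR⟩ := hH
  set R := resolv H z with hRdef
  set K := H - z • (1 : E →L[ℂ] E) with hK
  have hu : IsUnit K := by
    have h1 : IsUnit (algebraMap ℂ (E →L[ℂ] E) z - H) := hz
    rw [Algebra.algebraMap_eq_smul_one] at h1
    simpa [hK] using h1.neg
  have hKR : K * R = 1 := Ring.mul_inverse_cancel _ hu
  have hRK : R * K = 1 := Ring.inverse_mul_cancel _ hu
  have hR' : ∀ x, ContDiff ℝ 2 fun t => conjugate A R t x := hR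
  obtain ⟨R₁, hR₁⟩ := exists_hasConjugateDeriv hA (T := R) fun x =>
    (hR' x).differentiable (by norm_num) 0
  obtain ⟨R₂, hR₂⟩ := exists_hasConjugateDeriv hA (T := R₁) fun x => by
    have h1 : deriv (fun t => conjugate A R t x) = fun t => conjugate A R₁ t x :=
      funext fun t => (hR₁.hasDerivAt hA t x).deriv
    have h2 := (contDiff_succ_iff_deriv (n := 1)).1 (by simpa [one_add_one_eq_two] using hR' x)
    rw [h1] at h2
    exact h2.2.2.differentiable (by norm_num) 0
  -- Regularity is given for the resolvent R only, but K = H - z is its inverse. The first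
  -- derivative -K R₁ K is again a product of differentiable factors, whence the second commutator.
  have hKd : HasConjugateDeriv A K (-(K * R₁ * K)) := hR₁.inverse hA hRK hKR
  have hHd : HasConjugateDeriv A H (-(K * R₁ * K)) := by
    have h1 := hKd.add ((HasConjugateDeriv.one hA).smul z)
    simpa [hK] using h1
  have h1 := isCommutator_of_hasConjugateDeriv hHd
  have h2 : commutator H A = -I • (K * R₁ * K) := by
    have h3 := (isCommutator_iff.1 h1).unique hHd
    have h4 := congrArg (I • ·) h3
    simp only [smul_neg, smul_smul, I_mul_I, neg_smul, one_smul, neg_neg] at h4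
    rw [h4, neg_smul]
  have h3 := ((hKd.mul hA hR₂).mul hA hKd).smul (-I)
  rw [← h2] at h3
  exact ⟨h1, isCommutator_of_hasConjugateDeriv h3⟩

end Commutators

end Mourre

namespace Mourre

open Filter Topology Complex

/-! ### From the localised Mourre estimate to an estimate for all vectors. -/

section Spectral

variable {E : Type*} [NormedAddCommGroup E] [InnerProductSpace ℂ E] [CompleteSpace E]
  {A : E →ₗ.[ℂ] E}

/-! ### Consequences of the Mourre estimate -/

theorem inner_mul_self_apply {T : E →L[ℂ] E} (hT : IsSelfAdjoint T) (y : E) :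
    ⟪y, (T * T) y⟫_ℂ = (‖T y‖ ^ 2 : ℝ) := by
  rw [ContinuousLinearMap.isSelfAdjoint_iff_isSymmetric] at hT
  have h := hT y (T y)
  rw [mul_apply_eq_comp]
  refine h.symm.trans ?_
  change ⟪T y, T y⟫_ℂ = _
  rw [inner_self_eq_norm_sq_to_K]
  push_cast
  rfl

/-- A comparison vector by vector rather than in norm: f² ≤ g² gives f(T)² ≤ g(T)², tested at y. -/
theorem norm_cfc_apply_le (T : E →L[ℂ] E) {f g : ℝ → ℝ} (hf : ContinuousOn f (spectrum ℝ T))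
    (hg : ContinuousOn g (spectrum ℝ T)) (h : ∀ r ∈ spectrum ℝ T, |f r| ≤ |g r|) (y : E) :
    ‖cfc f T y‖ ≤ ‖cfc g T y‖ := by
  have h1 : cfc (fun r => f r * f r) T ≤ cfc (fun r => g r * g r) T :=
    cfc_mono fun r hr => by
      have := mul_self_le_mul_self (abs_nonneg _) (h r hr)
      simpa only [abs_mul_abs_self] using this
  rw [cfc_mul f f T, cfc_mul g g T, ContinuousLinearMap.le_def] at h1
  have h2 := h1.re_inner_nonneg_right y
  rw [sub_apply, inner_sub_right, inner_mul_self_apply (cfc_predicate f T),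
    inner_mul_self_apply (cfc_predicate g T), map_sub] at h2
  have h3 : ‖cfc f T y‖ ^ 2 ≤ ‖cfc g T y‖ ^ 2 := by
    simpa only [RCLike.re_to_complex, Complex.ofReal_re, sub_nonneg] using h2
  exact (sq_le_sq₀ (norm_nonneg _) (norm_nonneg _)).1 h3

/-- The spectral distribution of f(H)x does not charge the open complement of supp f: a compact set
there is dominated by a bump φ with φf = 0. This inclusion is the only property of the spectral
subspace, beyond its being closed, that the proof requires. -/
theorem cfc_apply_mem_spectralSubspace (H : E →L[ℂ] E) {J : Set ℝ} (f : C(ℝ, ℝ))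
    (hf : tsupport f ⊆ J) (x : E) : cfc f H x ∈ spectralSubspace H J := by
  refine Submodule.le_topologicalClosure _ (Submodule.subset_span ?_)
  change spectralDistribution H (cfc f H x) Jᶜ = 0
  refine measure_mono_null (Set.compl_subset_compl.2 hf) ?_
  have hopen : IsOpen (tsupport f)ᶜ := (isClosed_tsupport f).isOpen_compl
  rw [spectralDistribution, hopen.measure_eq_iSup_isCompact]
  simp only [ENNReal.iSup_eq_zero]
  intro K hK hKc
  obtain ⟨φ, hφ1, hφc, hφs, hφ01⟩ := exists_continuousMap_one_of_isCompact_subset_isOpen hKc hopen hK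
  have h1 := RealRMK.rieszMeasure_le_of_eq_one (spectralFunctional H (cfc f H x))
    (f := ⟨φ, hφc⟩) (fun r => (hφ01 r).1) hKc hφ1
  have h2 : spectralFunctional H (cfc f H x) ⟨φ, hφc⟩ = 0 := by
    change (⟪cfc f H x, cfc (fun r : ℝ => φ r) H (cfc f H x)⟫_ℂ).re = 0
    have h3 : cfc (fun r : ℝ => φ r) H * cfc f H = 0 := by
      rw [← cfc_mul (fun r : ℝ => φ r) f H φ.continuous.continuousOn f.continuous.continuousOn]
      have : (fun r => φ r * f r) = fun _ => (0 : ℝ) := by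
        ext r
        by_cases hr : r ∈ tsupport f
        · have : r ∉ tsupport φ := fun h => hφs h hr
          rw [image_eq_zero_of_notMem_tsupport this, zero_mul]
        · rw [image_eq_zero_of_notMem_tsupport hr, mul_zero]
      rw [this, cfc_const_zero]
    rw [← mul_apply_eq_comp, h3]
    simp
  rw [h2, ENNReal.ofReal_zero] at h1
  exact le_antisymm h1 zero_le

/-- The complementary spectral projection is controlled by `H - λ`. -/
theorem norm_sub_spectralMeasure_apply_le {H : E →L[ℂ] E} (hH : IsSelfAdjoint H) {J : Set ℝ}
    (hJ : IsOpen J) {lam δ : ℝ} (hδ : 0 < δ) (hI : Set.Icc (lam - δ) (lam + δ) ⊆ J) (y : E) :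
    δ * ‖y - spectralMeasure H J y‖ ≤ ‖H y - (lam : ℂ) • y‖ := by
  obtain ⟨f, hf1, -, hfs, hf01⟩ :=
    exists_continuousMap_one_of_isCompact_subset_isOpen isCompact_Icc hJ hI
  have : CompleteSpace (spectralSubspace H J) :=
    (Submodule.isClosed_topologicalClosure _).completeSpace_coe
  -- 1 - E(J) is a projection annihilating f(H)y, so E(J) can be replaced by a smooth cutoff f
  -- supported in J and equal to 1 within δ of λ.
  have h1 : ‖y - spectralMeasure H J y‖ ≤ ‖y - cfc f H y‖ := by
    have hmem := cfc_apply_mem_spectralSubspace H f hfs y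
    have h2 : y - spectralMeasure H J y
        = (spectralSubspace H J)ᗮ.starProjection (y - cfc f H y) := by
      rw [Submodule.starProjection_orthogonal_val, map_sub,
        Submodule.starProjection_eq_self_iff.2 hmem, spectralMeasure]
      abel
    rw [h2]
    exact Submodule.norm_starProjection_apply_le _ _
  have h2 : y - cfc f H y = cfc (fun r => 1 - f r) H y := by
    rw [cfc_sub (fun _ => (1 : ℝ)) f H continuousOn_const f.continuous.continuousOn,
      cfc_const_one ℝ H]
    rfl
  have h3 : H y - (lam : ℂ) • y = cfc (fun r : ℝ => r - lam) H y := by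
    rw [cfc_sub (fun r : ℝ => r) (fun _ => lam) H continuousOn_id continuousOn_const, cfc_id' ℝ H,
      cfc_const lam H, Algebra.algebraMap_eq_smul_one, Complex.coe_smul]
    rfl
  have h4 : δ * ‖cfc (fun r => 1 - f r) H y‖ = ‖cfc (fun r => δ * (1 - f r)) H y‖ := by
    rw [cfc_const_mul δ (fun r => 1 - f r) H (by fun_prop), smul_apply, norm_smul,
      Real.norm_of_nonneg hδ.le]
  calc _ ≤ δ * ‖y - cfc f H y‖ := by gcongr
    _ = ‖cfc (fun r => δ * (1 - f r)) H y‖ := by rw [h2, h4]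
    _ ≤ _ := by
        rw [h3]
        refine norm_cfc_apply_le H (by fun_prop) (by fun_prop) (fun r _ => ?_) y
        rw [abs_mul, abs_of_pos hδ, abs_of_nonneg (sub_nonneg.2 (hf01 r).2)]
        by_cases hr : r ∈ Set.Icc (lam - δ) (lam + δ)
        · rw [hf1 hr]; simp
        · have hd : δ ≤ |r - lam| := by
            by_contra! hlt
            obtain ⟨h5, h6⟩ := abs_lt.1 hlt
            exact hr ⟨by linarith, by linarith⟩
          have := (hf01 r).1
          nlinarith

theorem MourreEstimate.mul_norm_sq_le {H : E →L[ℂ] E} {J : Set ℝ} {a : ℝ}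
    (hM : MourreEstimate H A J a) (y : E) :
    a * ‖spectralMeasure H J y‖ ^ 2 ≤
      (⟪spectralMeasure H J y, (I • commutator H A) (spectralMeasure H J y)⟫_ℂ).re := by
  have hcs : CompleteSpace (spectralSubspace H J) :=
    (Submodule.isClosed_topologicalClosure _).completeSpace_coe
  have h := hM.le
  rw [ContinuousLinearMap.le_def] at h
  have h1 := h.re_inner_nonneg_right y
  have h2 : ∀ v, ⟪y, spectralMeasure H J v⟫_ℂ = ⟪spectralMeasure H J y, v⟫_ℂ := fun v =>
    (Submodule.inner_starProjection_left_eq_right _ y v).symm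
  have h3 : spectralMeasure H J (spectralMeasure H J y) = spectralMeasure H J y :=
    Submodule.starProjection_eq_self_iff.2 (Submodule.starProjection_apply_mem _ y)
  have h4 : ⟪y, (a • spectralMeasure H J) y⟫_ℂ = (a * ‖spectralMeasure H J y‖ ^ 2 : ℝ) := by
    rw [smul_apply, inner_smul_right_eq_smul, ← h3, h2, inner_self_eq_norm_sq_to_K, h3]
    simp
  rw [sub_apply, inner_sub_right, h4, mul_apply_eq_comp, mul_apply_eq_comp, h2, map_sub] at h1
  simpa only [RCLike.re_to_complex, Complex.ofReal_re, sub_nonneg] using h1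

/-- Split y = p + q along E(J). The cross terms, at most 2‖B‖‖p‖‖q‖, are absorbed by half of a‖p‖²,
which leaves a/2 and produces the term (2/a)‖B‖². -/
theorem MourreEstimate.le_re_inner {H : E →L[ℂ] E} {J : Set ℝ} {a : ℝ}
    (hM : MourreEstimate H A J a) (y : E) :
    a / 2 * ‖y‖ ^ 2 ≤ (⟪y, (I • commutator H A) y⟫_ℂ).re
      + (a / 2 + 2 / a * ‖commutator H A‖ ^ 2 + ‖commutator H A‖)
        * ‖y - spectralMeasure H J y‖ ^ 2 := by
  have hcs : CompleteSpace (spectralSubspace H J) :=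
    (Submodule.isClosed_topologicalClosure _).completeSpace_coe
  have ha := hM.pos
  have h0 := hM.mul_norm_sq_le y
  set B := I • commutator H A with hB
  have hBn : ‖B‖ = ‖commutator H A‖ := by rw [hB, norm_smul, norm_I, one_mul]
  rw [← hBn]
  set p := spectralMeasure H J y with hp
  set q := y - p with hq
  have hy : y = p + q := by rw [hq]; abel
  have horth : ⟪p, q⟫_ℂ = 0 := by
    have h : ⟪q, p⟫_ℂ = 0 :=
      Submodule.starProjection_inner_eq_zero y p (Submodule.starProjection_apply_mem _ y)
    rw [← inner_conj_symm, h, map_zero]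
  have hsq : ‖y‖ ^ 2 = ‖p‖ ^ 2 + ‖q‖ ^ 2 := by
    rw [hy, norm_add_sq (𝕜 := ℂ), horth]; simp
  have hin : (⟪y, B y⟫_ℂ).re = (⟪p, B p⟫_ℂ).re + (⟪p, B q⟫_ℂ).re + (⟪q, B p⟫_ℂ).re
      + (⟪q, B q⟫_ℂ).re := by
    rw [hy, map_add, inner_add_left, inner_add_right, inner_add_right]
    simp only [Complex.add_re]; ring
  have hbd : ∀ u v, -(‖B‖ * ‖u‖ * ‖v‖) ≤ (⟪u, B v⟫_ℂ).re := fun u v => by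
    have h1 := (Complex.abs_re_le_norm _).trans (norm_inner_le_norm (𝕜 := ℂ) u (B v))
    have h2 := mul_le_mul_of_nonneg_left (B.le_opNorm v) (norm_nonneg u)
    have h3 := (abs_le.1 h1).1
    linarith
  have h1 := hbd p q
  have h2 := hbd q p
  have h3 := hbd q q
  have h4 : 2 * ‖B‖ * ‖p‖ * ‖q‖ ≤ a / 2 * ‖p‖ ^ 2 + 2 / a * ‖B‖ ^ 2 * ‖q‖ ^ 2 := by
    have : a / 2 * ‖p‖ ^ 2 + 2 / a * ‖B‖ ^ 2 * ‖q‖ ^ 2 - 2 * ‖B‖ * ‖p‖ * ‖q‖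
        = 2 / a * (a / 2 * ‖p‖ - ‖B‖ * ‖q‖) ^ 2 := by
      field_simp; ring
    have h5 : 0 ≤ 2 / a * (a / 2 * ‖p‖ - ‖B‖ * ‖q‖) ^ 2 := by positivity
    linarith
  rw [hin, hsq]
  linarith

/-- The Mourre estimate excludes `δ > ‖H‖ + |λ|`. -/
theorem MourreEstimate.le_norm_add_abs [Nontrivial E] (hA : IsSelfAdjoint A) {H : E →L[ℂ] E}
    (hH : IsCommutator A H (commutator H A)) {J : Set ℝ} {a : ℝ} (hM : MourreEstimate H A J a)
    {lam δ : ℝ} (hδ : 0 < δ) (hI : Set.Icc (lam - δ) (lam + δ) ⊆ J) : δ ≤ ‖H‖ + |lam| := by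
  -- E(J) cannot fix this x, as the Mourre estimate would contradict its choice. So q = x - E(J)x is
  -- nonzero, and on it H - λ is bounded below by δ.
  obtain ⟨x, hx⟩ := (isCommutator_iff.1 hH).exists_re_inner_lt hA hM.pos
  rw [neg_apply, neg_neg] at hx
  have h1 := norm_sub_spectralMeasure_apply_le hM.isOfClass.1 hM.isOpen hδ hI
    (x - spectralMeasure H J x)
  have hcs : CompleteSpace (spectralSubspace H J) :=
    (Submodule.isClosed_topologicalClosure _).completeSpace_coe
  have h3 : spectralMeasure H J (spectralMeasure H J x) = spectralMeasure H J x :=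
    Submodule.starProjection_eq_self_iff.2 (Submodule.starProjection_apply_mem _ x)
  rw [map_sub, h3, sub_self, sub_zero] at h1
  set q := x - spectralMeasure H J x with hq
  have hq0 : 0 < ‖q‖ := by
    rw [norm_pos_iff]
    intro h0
    rw [h0, eq_comm, sub_eq_zero] at hq
    have h4 := hM.mul_norm_sq_le x
    rw [← hq] at h4
    exact absurd hx (not_lt.2 h4)
  have h2 : ‖H q - (lam : ℂ) • q‖ ≤ (‖H‖ + |lam|) * ‖q‖ := by
    refine (norm_sub_le _ _).trans ?_
    rw [norm_smul, Complex.norm_real, Real.norm_eq_abs, add_mul]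
    gcongr
    exact H.le_opNorm q
  exact le_of_mul_le_mul_right (h1.trans h2) hq0

end Spectral

end Mourre

namespace Mourre

open Filter Topology Complex

/-! ### The weights built from (1 + A²)⁻¹ and their dependence on ε. -/

section Weights

variable {E : Type*} [NormedAddCommGroup E] [InnerProductSpace ℂ E] [CompleteSpace E]
  {A : E →ₗ.[ℂ] E} {S : E →L[ℂ] E}

/-! ### The operator `(1 + A²)⁻¹` and its square root -/

theorem IsInvOneAddSq.inner_eq (hA : IsSelfAdjoint A) (hS : IsInvOneAddSq A S) (x : E) :
    ∃ w, (S x, w) ∈ A.graph ∧ ⟪S x, x⟫_ℂ = (‖S x‖ ^ 2 + ‖w‖ ^ 2 : ℝ) := by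
  obtain ⟨w, h1, h2⟩ := hS x
  refine ⟨w, h1, ?_⟩
  have h := graph_inner_eq hA h1 h2
  rw [inner_sub_right, inner_self_eq_norm_sq_to_K, inner_self_eq_norm_sq_to_K, eq_comm,
    sub_eq_iff_eq_add] at h
  rw [h]
  push_cast
  rw [add_comm]
  rfl

theorem IsInvOneAddSq.isPositive (hA : IsSelfAdjoint A) (hS : IsInvOneAddSq A S) :
    S.IsPositive := by
  rw [ContinuousLinearMap.isPositive_iff_complex]
  intro x
  obtain ⟨w, -, h⟩ := hS.inner_eq hA x
  rw [h]
  refine ⟨by simp only [RCLike.re_to_complex, Complex.ofReal_re], ?_⟩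
  rw [RCLike.re_to_complex, Complex.ofReal_re]
  positivity

theorem IsInvOneAddSq.isSelfAdjoint (hA : IsSelfAdjoint A) (hS : IsInvOneAddSq A S) :
    IsSelfAdjoint S :=
  (hS.isPositive hA).isSelfAdjoint

theorem IsInvOneAddSq.spectrum_subset (hA : IsSelfAdjoint A) (hS : IsInvOneAddSq A S) :
    spectrum ℝ S ⊆ Set.Icc 0 1 := by
  intro r hr
  have h0 : (0 : E →L[ℂ] E) ≤ S := (ContinuousLinearMap.nonneg_iff_isPositive S).2 (hS.isPositive hA)
  have hnorm : ‖S‖ ≤ 1 := by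
    refine ContinuousLinearMap.opNorm_le_bound _ zero_le_one fun x => ?_
    obtain ⟨w, -, h⟩ := hS.inner_eq hA x
    have h1 := (Complex.abs_re_le_norm _).trans (norm_inner_le_norm (𝕜 := ℂ) (S x) x)
    rw [h, Complex.ofReal_re] at h1
    have h2 := (le_abs_self _).trans h1
    rcases (norm_nonneg (S x)).eq_or_lt with h3 | h3
    · rw [← h3]; positivity
    · nlinarith [sq_nonneg ‖w‖]
  refine ⟨spectrum_nonneg_of_nonneg h0 hr, ?_⟩
  have h1 := spectrum.norm_le_norm_mul_of_mem hr
  have h2 : ‖(1 : E →L[ℂ] E)‖ ≤ 1 := ContinuousLinearMap.norm_id_le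
  have h3 : ‖S‖ * ‖(1 : E →L[ℂ] E)‖ ≤ 1 := mul_le_one₀ hnorm (norm_nonneg _) h2
  exact (le_abs_self r).trans (h1.trans h3)

theorem IsInvOneAddSq.sqrt_mul_sqrt (hA : IsSelfAdjoint A) (hS : IsInvOneAddSq A S) :
    cfc Real.sqrt S * cfc Real.sqrt S = S := by
  have hsa := hS.isSelfAdjoint hA
  rw [← cfc_mul Real.sqrt Real.sqrt S Real.continuous_sqrt.continuousOn
    Real.continuous_sqrt.continuousOn]
  conv_rhs => rw [← cfc_id' ℝ S]
  exact cfc_congr fun r hr => Real.mul_self_sqrt (hS.spectrum_subset hA hr).1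

theorem IsInvOneAddSq.norm_sqrt_sq (hA : IsSelfAdjoint A) (hS : IsInvOneAddSq A S) (x : E) :
    ⟪S x, x⟫_ℂ = (‖cfc Real.sqrt S x‖ ^ 2 : ℝ) := by
  have h := inner_mul_self_apply (cfc_predicate Real.sqrt S) x
  rw [hS.sqrt_mul_sqrt hA] at h
  rw [← inner_conj_symm, h, conj_ofReal]

theorem IsInvOneAddSq.denseRange_sqrt (hA : IsSelfAdjoint A) (hS : IsInvOneAddSq A S) :
    DenseRange (cfc Real.sqrt S : E →L[ℂ] E) := by
  have h : ((cfc Real.sqrt S : E →L[ℂ] E).range)ᗮ = ⊥ := by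
    have hsa : IsSelfAdjoint (cfc Real.sqrt S) := cfc_predicate Real.sqrt S
    rw [ContinuousLinearMap.orthogonal_range, ← ContinuousLinearMap.star_eq_adjoint, hsa.star_eq,
      LinearMap.ker_eq_bot']
    intro x hx
    have hSx : S x = 0 := by
      rw [← hS.sqrt_mul_sqrt hA, mul_apply_eq_comp]
      change cfc Real.sqrt S x = 0 at hx
      rw [hx, map_zero]
    obtain ⟨w, h1, h2⟩ := hS x
    rw [hSx] at h1 h2
    have hw : w = 0 := A.graph_fst_eq_zero_snd h1 rfl
    rw [hw, sub_zero] at h2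
    exact A.graph_fst_eq_zero_snd h2 rfl
  have h2 := (Submodule.topologicalClosure_eq_top_iff (K := (cfc Real.sqrt S : E →L[ℂ] E).range)).2 h
  exact Submodule.dense_iff_topologicalClosure_eq_top.2 h2

/-- `A (1 + A²)^(-1/2)` is everywhere defined and contractive. -/
theorem IsInvOneAddSq.exists_graph_sqrt (hA : IsSelfAdjoint A) (hS : IsInvOneAddSq A S) (x : E) :
    ∃ w, (cfc Real.sqrt S x, w) ∈ A.graph ∧ ‖w‖ ≤ ‖x‖ := by
  set Q : E →L[ℂ] E := cfc Real.sqrt S with hQ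
  -- ‖A S y‖² = ⟪S y, y⟫ - ‖S y‖² ≤ ‖Q y‖² is the claim for x = Q y. These x are dense, and A is
  -- closed.
  have hex : ∀ y, ∃ w, (S y, w) ∈ A.graph ∧ ‖w‖ ≤ ‖Q y‖ := fun y => by
    obtain ⟨w, h1, h2⟩ := hS.inner_eq hA y
    refine ⟨w, h1, ?_⟩
    have h3 : ‖S y‖ ^ 2 + ‖w‖ ^ 2 = ‖Q y‖ ^ 2 := by
      rw [hS.norm_sqrt_sq hA] at h2
      exact_mod_cast h2.symm
    refine (sq_le_sq₀ (norm_nonneg _) (norm_nonneg _)).1 ?_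
    nlinarith [sq_nonneg ‖S y‖]
  choose W hW hWn using hex
  obtain ⟨u, hu, hlim⟩ := mem_closure_iff_seq_limit.1 ((hS.denseRange_sqrt hA) x)
  choose y hy using hu
  have hsub : ∀ m n, ‖W (y m) - W (y n)‖ ≤ ‖u m - u n‖ := fun m n => by
    have h1 := A.graph.sub_mem (hW (y m)) (hW (y n))
    rw [Prod.mk_sub_mk, ← map_sub] at h1
    rw [A.mem_graph_snd_inj h1 (hW (y m - y n)) rfl, ← hy, ← hy, ← map_sub]
    exact hWn _
  have hcs : CauchySeq fun n => W (y n) := by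
    rw [Metric.cauchySeq_iff]
    intro ε hε
    obtain ⟨N, hN⟩ := Metric.cauchySeq_iff.1 hlim.cauchySeq ε hε
    refine ⟨N, fun m hm n hn => ?_⟩
    have h1 := hN m hm n hn
    rw [dist_eq_norm] at h1 ⊢
    exact (hsub m n).trans_lt h1
  obtain ⟨w, hw⟩ := cauchySeq_tendsto_of_complete hcs
  have hSy : ∀ n, S (y n) = Q (u n) := fun n => by
    rw [← hy, ← mul_apply_eq_comp, hQ, hS.sqrt_mul_sqrt hA]
  refine ⟨w, ?_, ?_⟩
  · have hcl : IsClosed (A.graph : Set (E × E)) := hA.isClosed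
    refine hcl.mem_of_tendsto (((Q.continuous.tendsto x).comp hlim).prodMk_nhds hw)
      (Eventually.of_forall fun n => ?_)
    have := hW (y n)
    rwa [hSy] at this
  · refine le_of_tendsto_of_tendsto hw.norm hlim.norm (Eventually.of_forall fun n => ?_)
    have := hWn (y n)
    change ‖W (y n)‖ ≤ ‖u n‖
    rwa [← hy n]

/-! ### Differentiation of the functional calculus in a parameter -/

/-- The derivative is uniformly continuous on the compact set [u, v] × spectrum, so the mean value
inequality makes the remainder o(e - e₀) uniformly on the spectrum, hence in operator norm. -/
theorem hasDerivAt_cfc_param (T : E →L[ℂ] E) {f f' : ℝ → ℝ → ℝ} {u v e₀ : ℝ}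
    (he₀ : e₀ ∈ Set.Ioo u v)
    (hf : ∀ e ∈ Set.Icc u v, ContinuousOn (f e) (spectrum ℝ T))
    (hd : ∀ e ∈ Set.Icc u v, ∀ s ∈ spectrum ℝ T, HasDerivAt (fun e => f e s) (f' e s) e)
    (hf' : ContinuousOn (fun p : ℝ × ℝ => f' p.1 p.2) (Set.Icc u v ×ˢ spectrum ℝ T)) :
    HasDerivAt (fun e => cfc (f e) T) (cfc (f' e₀) T) e₀ := by
  have hcomp : IsCompact (spectrum ℝ T) := ContinuousFunctionalCalculus.isCompact_spectrum T
  have huc := (isCompact_Icc.prod hcomp).uniformContinuousOn_of_continuous hf'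
  rw [Metric.uniformContinuousOn_iff] at huc
  have hf'0 : ContinuousOn (f' e₀) (spectrum ℝ T) :=
    hf'.comp (f := fun s => (e₀, s)) (by fun_prop) fun s hs => ⟨Set.Ioo_subset_Icc_self he₀, hs⟩
  rw [hasDerivAt_iff_isLittleO, Asymptotics.isLittleO_iff]
  intro c hc
  obtain ⟨η, hη, hη'⟩ := huc c hc
  have hnhds : ∀ᶠ e in 𝓝 e₀, e ∈ Set.Ioo u v ∩ Metric.ball e₀ η :=
    (isOpen_Ioo.inter Metric.isOpen_ball).mem_nhds ⟨he₀, Metric.mem_ball_self hη⟩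
  filter_upwards [hnhds] with e he
  have heI : e ∈ Set.Icc u v := Set.Ioo_subset_Icc_self he.1
  have he0I : e₀ ∈ Set.Icc u v := Set.Ioo_subset_Icc_self he₀
  have e1 : cfc (f e) T - cfc (f e₀) T - (e - e₀) • cfc (f' e₀) T
      = cfc (fun s => f e s - f e₀ s - (e - e₀) * f' e₀ s) T := by
    rw [cfc_sub (fun s => f e s - f e₀ s) (fun s => (e - e₀) * f' e₀ s) T
      ((hf e heI).sub (hf e₀ he0I)) (hf'0.const_mul _),
      cfc_sub (f e) (f e₀) T (hf e heI) (hf e₀ he0I), cfc_const_mul _ _ T hf'0]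
  rw [e1]
  refine norm_cfc_le (by positivity) fun s hs => ?_
  have hconv := (convex_Ioo u v).inter (convex_ball e₀ η)
  have h := hconv.norm_image_sub_le_of_norm_hasDerivWithin_le
    (f := fun t => f t s - t * f' e₀ s) (f' := fun t => f' t s - f' e₀ s) (C := c)
    (fun t ht => by
      have := (hd t (Set.Ioo_subset_Icc_self ht.1) s hs).sub
        ((hasDerivAt_id t).mul_const (f' e₀ s))
      exact (this.congr_deriv (by rw [one_mul])).hasDerivWithinAt)
    (fun t ht => by
      have := hη' (t, s) ⟨Set.Ioo_subset_Icc_self ht.1, hs⟩ (e₀, s) ⟨he0I, hs⟩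
        (by rw [Prod.dist_eq, dist_self]; exact max_lt ht.2 hη)
      exact this.le)
    ⟨he₀, Metric.mem_ball_self hη⟩ he
  have e2 : f e s - f e₀ s - (e - e₀) * f' e₀ s
      = f e s - e * f' e₀ s - (f e₀ s - e₀ * f' e₀ s) := by ring
  rw [e2]
  exact h

/-! ### The regularised weights -/

/-- The weight `S^(1/2) (S + ε²)^((σ - 1)/2)`, which regularises `S^(σ/2)`. -/
noncomputable def weight (S : E →L[ℂ] E) (σ ε : ℝ) : E →L[ℂ] E :=
  cfc (fun s : ℝ => √s * (s + ε ^ 2) ^ ((σ - 1) / 2)) S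

/-- The derivative of `weight` in `ε`. -/
noncomputable def weightDeriv (S : E →L[ℂ] E) (σ ε : ℝ) : E →L[ℂ] E :=
  cfc (fun s : ℝ => √s * ((σ - 1) / 2 * (s + ε ^ 2) ^ ((σ - 1) / 2 - 1) * (2 * ε))) S

theorem continuousOn_add_sq_rpow {K : Set ℝ} (hK : K ⊆ Set.Icc 0 1) {ε : ℝ} (hε : 0 < ε) (r : ℝ) :
    ContinuousOn (fun s : ℝ => (s + ε ^ 2) ^ r) K := by
  refine ContinuousOn.rpow_const (by fun_prop) fun s hs => Or.inl ?_
  have := (hK hs).1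
  positivity

theorem add_sq_rpow_le {s ε σ : ℝ} (hs : 0 ≤ s) (hε : 0 < ε) (hσ : σ ≤ 1) :
    (s + ε ^ 2) ^ ((σ - 1) / 2) ≤ ε ^ (σ - 1) := by
  calc (s + ε ^ 2) ^ ((σ - 1) / 2) ≤ (ε ^ 2) ^ ((σ - 1) / 2) :=
        Real.rpow_le_rpow_of_nonpos (by positivity) (by linarith) (by linarith)
    _ = ε ^ (σ - 1) := by
        rw [← Real.rpow_natCast, ← Real.rpow_mul hε.le]
        congr 1
        push_cast
        ring

theorem isSelfAdjoint_weight (S : E →L[ℂ] E) (σ ε : ℝ) : IsSelfAdjoint (weight S σ ε) :=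
  cfc_predicate _ _

theorem IsInvOneAddSq.norm_weight_le (hA : IsSelfAdjoint A) (hS : IsInvOneAddSq A S) {σ ε : ℝ}
    (hε : 0 < ε) (hσ : σ ≤ 1) (hσ' : 0 ≤ σ) : ‖weight S σ ε‖ ≤ 1 := by
  refine norm_cfc_le zero_le_one fun s hs => ?_
  obtain ⟨h0, h1⟩ := hS.spectrum_subset hA hs
  rw [Real.norm_of_nonneg (by positivity)]
  rcases h0.eq_or_lt with h | h
  · rw [← h]; simp
  · calc √s * (s + ε ^ 2) ^ ((σ - 1) / 2) ≤ √s * s ^ ((σ - 1) / 2) := by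
          gcongr √s * ?_
          exact Real.rpow_le_rpow_of_nonpos h (by nlinarith) (by linarith)
      _ = s ^ (σ / 2) := by
          rw [Real.sqrt_eq_rpow, ← Real.rpow_add h]; congr 1; ring
      _ ≤ 1 := Real.rpow_le_one h0 h1 (by linarith)

/-- The factor S^(1/2) absorbs A at no cost; the remaining factor has norm at most ε^(σ-1). -/
theorem IsInvOneAddSq.exists_graph_weight (hA : IsSelfAdjoint A) (hS : IsInvOneAddSq A S)
    {σ ε : ℝ} (hε : 0 < ε) (hσ : σ ≤ 1) (x : E) :
    ∃ w, (weight S σ ε x, w) ∈ A.graph ∧ ‖w‖ ≤ ε ^ (σ - 1) * ‖x‖ := by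
  have hsub := hS.spectrum_subset hA
  obtain ⟨w, h1, h2⟩ := hS.exists_graph_sqrt hA (cfc (fun s : ℝ => (s + ε ^ 2) ^ ((σ - 1) / 2)) S x)
  refine ⟨w, ?_, h2.trans ?_⟩
  · rw [← mul_apply_eq_comp, ← cfc_mul _ _ S Real.continuous_sqrt.continuousOn
      (continuousOn_add_sq_rpow hsub hε _)] at h1
    exact h1
  · refine ContinuousLinearMap.le_of_opNorm_le _ (norm_cfc_le (by positivity) fun s hs => ?_) x
    have h0 := (hsub hs).1
    rw [Real.norm_of_nonneg (by positivity)]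
    exact add_sq_rpow_le h0 hε hσ

/-- The extra negative power of s + ε² is paid for by 2ε√s ≤ s + ε². -/
theorem IsInvOneAddSq.norm_weightDeriv_le (hA : IsSelfAdjoint A) (hS : IsInvOneAddSq A S)
    {σ ε : ℝ} (hε : 0 < ε) (hσ : σ ≤ 1) :
    ‖weightDeriv S σ ε‖ ≤ (1 - σ) / 2 * ε ^ (σ - 1) := by
  have h1σ : 0 ≤ 1 - σ := by linarith
  refine norm_cfc_le (by positivity) fun s hs => ?_
  have h0 := (hS.spectrum_subset hA hs).1
  have hp : 0 < s + ε ^ 2 := by positivity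
  have h1 := add_sq_rpow_le h0 hε hσ
  have h2 : √s * (2 * ε) ≤ s + ε ^ 2 := by nlinarith [sq_nonneg (√s - ε), Real.sq_sqrt h0]
  have e : √s * ((σ - 1) / 2 * (s + ε ^ 2) ^ ((σ - 1) / 2 - 1) * (2 * ε))
      = -((1 - σ) / 2 * (s + ε ^ 2) ^ ((σ - 1) / 2) * (√s * (2 * ε) / (s + ε ^ 2))) := by
    rw [Real.rpow_sub_one hp.ne']; ring
  rw [e, norm_neg, Real.norm_of_nonneg (by positivity)]
  have h3 : √s * (2 * ε) / (s + ε ^ 2) ≤ 1 := (div_le_one hp).2 h2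
  calc _ ≤ (1 - σ) / 2 * ε ^ (σ - 1) * 1 := by gcongr
    _ = _ := mul_one _

theorem IsInvOneAddSq.hasDerivAt_weight (hA : IsSelfAdjoint A) (hS : IsInvOneAddSq A S) (σ : ℝ)
    {ε : ℝ} (hε : 0 < ε) : HasDerivAt (weight S σ) (weightDeriv S σ ε) ε := by
  have hsub := hS.spectrum_subset hA
  refine hasDerivAt_cfc_param S
    (f := fun e s => √s * (s + e ^ 2) ^ ((σ - 1) / 2))
    (f' := fun e s => √s * ((σ - 1) / 2 * (s + e ^ 2) ^ ((σ - 1) / 2 - 1) * (2 * e)))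
    (u := ε / 2) (v := 2 * ε) ⟨by linarith, by linarith⟩ (fun e he => ?_) (fun e he s hs => ?_) ?_
  · have : 0 < e := by linarith [he.1]
    exact Real.continuous_sqrt.continuousOn.mul (continuousOn_add_sq_rpow hsub this _)
  · have h1 : 0 < e := by linarith [he.1]
    have h2 := (hsub hs).1
    have h3 : HasDerivAt (fun e : ℝ => s + e ^ 2) (2 * e) e := by
      simpa using (hasDerivAt_pow 2 e).const_add s
    have h4 := (h3.rpow_const (p := (σ - 1) / 2) (Or.inl (by positivity))).const_mul √s
    refine h4.congr_deriv ?_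
    ring
  · have h3 : ContinuousOn (fun p : ℝ × ℝ => (p.2 + p.1 ^ 2) ^ ((σ - 1) / 2 - 1))
        (Set.Icc (ε / 2) (2 * ε) ×ˢ spectrum ℝ S) := by
      refine ContinuousOn.rpow_const (by fun_prop) fun p hp => Or.inl ?_
      have h1 : 0 < p.1 := by linarith [hp.1.1]
      have h2 := (hsub hp.2).1
      positivity
    fun_prop

/-- The two symbols differ by at most ε^σ uniformly in s ∈ [0,1], so the convergence is in norm. -/
theorem IsInvOneAddSq.tendsto_weight (hA : IsSelfAdjoint A) (hS : IsInvOneAddSq A S) {σ : ℝ}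
    (hσ : σ ≤ 1) (hσ' : 0 < σ) :
    Tendsto (weight S σ) (𝓝[>] 0) (𝓝 (cfc (fun s : ℝ => s ^ (σ / 2)) S)) := by
  have hsub := hS.spectrum_subset hA
  have hlim : Tendsto (fun ε : ℝ => ε ^ σ) (𝓝[>] 0) (𝓝 0) := by
    have := (Real.continuousAt_rpow_const 0 σ (Or.inr hσ'.le)).tendsto
    rw [Real.zero_rpow hσ'.ne'] at this
    exact this.mono_left nhdsWithin_le_nhds
  rw [tendsto_iff_norm_sub_tendsto_zero]
  refine squeeze_zero' (Eventually.of_forall fun _ => norm_nonneg _) ?_ hlim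
  filter_upwards [self_mem_nhdsWithin] with ε hε
  have hε : 0 < ε := hε
  rw [weight, ← cfc_sub (fun s : ℝ => √s * (s + ε ^ 2) ^ ((σ - 1) / 2)) (fun s : ℝ => s ^ (σ / 2)) S
    (Real.continuous_sqrt.continuousOn.mul (continuousOn_add_sq_rpow hsub hε _))
    (Real.continuous_rpow_const (by positivity)).continuousOn]
  refine norm_cfc_le (by positivity) fun s hs => ?_
  have h0 := (hsub hs).1
  have hp : 0 < s + ε ^ 2 := by positivity
  have e1 : ∀ u : ℝ, 0 < u → u ^ (σ / 2) = √u * u ^ ((σ - 1) / 2) := fun u hu => by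
    rw [Real.sqrt_eq_rpow, ← Real.rpow_add hu]; congr 1; ring
  have h1 : s ^ (σ / 2) ≤ (s + ε ^ 2) ^ (σ / 2) :=
    Real.rpow_le_rpow h0 (by nlinarith) (by linarith)
  rw [e1 _ hp] at h1
  have h2 : √(s + ε ^ 2) ≤ √s + ε := by
    rw [Real.sqrt_le_left (by positivity)]
    nlinarith [Real.sq_sqrt h0, Real.sqrt_nonneg s]
  have h3 : √s * (s + ε ^ 2) ^ ((σ - 1) / 2) ≤ s ^ (σ / 2) := by
    rcases h0.eq_or_lt with h | h
    · rw [← h, Real.sqrt_zero, zero_mul]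
      exact Real.rpow_nonneg le_rfl _
    · rw [e1 s h]
      gcongr √s * ?_
      exact Real.rpow_le_rpow_of_nonpos h (by nlinarith) (by linarith)
  have h4 : (s + ε ^ 2) ^ ((σ - 1) / 2) * ε ≤ ε ^ σ := by
    calc _ ≤ ε ^ (σ - 1) * ε := by gcongr; exact add_sq_rpow_le h0 hε hσ
      _ = ε ^ σ := by rw [Real.rpow_sub_one hε.ne']; field_simp
  have h5 : √(s + ε ^ 2) * (s + ε ^ 2) ^ ((σ - 1) / 2)
      ≤ (√s + ε) * (s + ε ^ 2) ^ ((σ - 1) / 2) := by gcongr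
  rw [Real.norm_eq_abs, abs_sub_comm, abs_of_nonneg (by linarith)]
  linarith

end Weights

end Mourre

namespace Mourre

open Filter Topology

/-! ### The nonlinear Gronwall inequality. -/

section Gronwall

/-! ### A Gronwall inequality with a square root term -/

/-- The barrier is φ² exp(k(ε₀ - e)): the exponential handles the linear term, and φ = √w +
(integral of b e^(σ-3/2)) handles the other two, with w the integral of the inhomogeneity. The
hypothesis σ > 1/2 keeps the barrier finite at 0. -/
theorem norm_le_of_norm_deriv_lt_sqrt {X : Type*} [NormedAddCommGroup X] [NormedSpace ℝ X]
    {F F' : ℝ → X} {ε₀ σ b c k ω : ℝ} (hσ : 1 / 2 < σ) (hb : 0 ≤ b) (hc : 0 ≤ c)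
    (hk : 0 ≤ k) (hω : 0 < ω) (hF : ∀ ε ∈ Set.Ioc 0 ε₀, HasDerivAt F (F' ε) ε)
    (hF' : ∀ ε ∈ Set.Ioc 0 ε₀, ‖F' ε‖ <
      c * ε ^ (σ - 1) + 2 * b * ε ^ (σ - 3 / 2) * √‖F ε‖ + k * ‖F ε‖)
    (h0 : ‖F ε₀‖ ≤ ω) {ε : ℝ} (hε : ε ∈ Set.Ioc 0 ε₀) :
    ‖F ε‖ ≤ (√(ω + c * ε₀ ^ σ / σ) + b * ε₀ ^ (σ - 1 / 2) / (σ - 1 / 2)) ^ 2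
      * Real.exp (k * ε₀) := by
  have hs : 0 < σ - 1 / 2 := by linarith
  have hσ0 : 0 < σ := by linarith
  have hε0 : 0 < ε₀ := hε.1.trans_le hε.2
  -- the comparison function, as a function of `ε₀ - e`
  set w : ℝ → ℝ := fun e => ω + c * (ε₀ ^ σ - e ^ σ) / σ with hw
  set φ : ℝ → ℝ := fun e => √(w e) + b * (ε₀ ^ (σ - 1 / 2) - e ^ (σ - 1 / 2)) / (σ - 1 / 2) with hφ
  set B : ℝ → ℝ := fun e => φ e ^ 2 * Real.exp (k * (ε₀ - e)) with hB
  have hwpos : ∀ e ∈ Set.Ioc 0 ε₀, 0 < w e := fun e he => by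
    have h1 : e ^ σ ≤ ε₀ ^ σ := Real.rpow_le_rpow he.1.le he.2 hσ0.le
    have h2 : 0 ≤ c * (ε₀ ^ σ - e ^ σ) / σ := div_nonneg (mul_nonneg hc (sub_nonneg.2 h1)) hσ0.le
    simp only [hw]; linarith
  have hφw : ∀ e ∈ Set.Ioc 0 ε₀, √(w e) ≤ φ e := fun e he => by
    have h1 : e ^ (σ - 1 / 2) ≤ ε₀ ^ (σ - 1 / 2) := Real.rpow_le_rpow he.1.le he.2 hs.le
    have h2 := div_nonneg (mul_nonneg hb (sub_nonneg.2 h1)) hs.le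
    simp only [hφ]; linarith
  have hwd : ∀ e ∈ Set.Ioc 0 ε₀, HasDerivAt w (-(c * e ^ (σ - 1))) e := fun e he => by
    have h1 := Real.hasDerivAt_rpow_const (x := e) (p := σ) (Or.inl he.1.ne')
    refine ((((h1.const_sub (ε₀ ^ σ)).const_mul c).div_const σ).const_add ω).congr_deriv ?_
    field_simp
  have hφd : ∀ e ∈ Set.Ioc 0 ε₀, HasDerivAt φ
      (-(c * e ^ (σ - 1)) / (2 * √(w e)) - b * e ^ (σ - 3 / 2)) e := fun e he => by
    have h1 := Real.hasDerivAt_rpow_const (x := e) (p := σ - 1 / 2) (Or.inl he.1.ne')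
    have h2 := (hwd e he).sqrt (hwpos e he).ne'
    refine (h2.add (((h1.const_sub (ε₀ ^ (σ - 1 / 2))).const_mul b).div_const
      (σ - 1 / 2))).congr_deriv ?_
    rw [show σ - 1 / 2 - 1 = σ - 3 / 2 by ring, mul_neg b, mul_left_comm b, neg_div _ (_ * (b * _)),
      mul_div_cancel_left₀ _ hs.ne']
    exact (sub_eq_add_neg _ _).symm
  have hBd : ∀ e ∈ Set.Ioc 0 ε₀, HasDerivAt B
      (2 * φ e * (-(c * e ^ (σ - 1)) / (2 * √(w e)) - b * e ^ (σ - 3 / 2))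
        * Real.exp (k * (ε₀ - e)) - k * B e) e := fun e he => by
    have h1 : HasDerivAt (fun e : ℝ => Real.exp (k * (ε₀ - e)))
        (Real.exp (k * (ε₀ - e)) * (-k)) e := by
      have h2 : HasDerivAt (fun e : ℝ => k * (ε₀ - e)) (-k) e := by
        simpa using ((hasDerivAt_id e).const_sub ε₀).const_mul k
      exact h2.exp
    refine (((hφd e he).pow 2).mul h1).congr_deriv ?_
    simp only [hB, Pi.pow_apply]
    push_cast
    ring
  have hmem : ∀ t ∈ Set.Icc 0 (ε₀ - ε), ε₀ - t ∈ Set.Ioc 0 ε₀ := fun t ht =>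
    ⟨by linarith [ht.2, hε.1], by linarith [ht.1]⟩
  -- The bound is known at ε₀ and is propagated downwards, hence the reflection t = ε₀ - e. The
  -- strict hypothesis on F′ is what a fencing argument needs where ‖F‖ meets the barrier.
  have key := image_norm_le_of_norm_deriv_right_lt_deriv_boundary'
    (f := fun t => F (ε₀ - t)) (f' := fun t => -F' (ε₀ - t)) (a := 0) (b := ε₀ - ε)
    (fun t ht => ((hF _ (hmem t ht)).comp_const_sub ε₀ t).continuousAt.continuousWithinAt)
    (fun t ht => ((hF _ (hmem t (Set.Ico_subset_Icc_self ht))).comp_const_sub ε₀ t).hasDerivWithinAt)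
    (B := fun t => B (ε₀ - t)) (B' := fun t => -(2 * φ (ε₀ - t) *
      (-(c * (ε₀ - t) ^ (σ - 1)) / (2 * √(w (ε₀ - t))) - b * (ε₀ - t) ^ (σ - 3 / 2))
        * Real.exp (k * (ε₀ - (ε₀ - t))) - k * B (ε₀ - t))) ?_
    (fun t ht => ((hBd _ (hmem t ht)).comp_const_sub ε₀ t).continuousAt.continuousWithinAt)
    (fun t ht => ((hBd _ (hmem t (Set.Ico_subset_Icc_self ht))).comp_const_sub ε₀ t).hasDerivWithinAt) ?_
    (Set.right_mem_Icc.2 (by linarith [hε.2]))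
  · rw [sub_sub_cancel] at key
    refine key.trans ?_
    have hsw : 0 ≤ √(w ε) := Real.sqrt_nonneg _
    have h1 : √(w ε) ≤ √(ω + c * ε₀ ^ σ / σ) := by
      refine Real.sqrt_le_sqrt ?_
      have : 0 ≤ ε ^ σ := Real.rpow_nonneg hε.1.le _
      simp only [hw]
      gcongr
      linarith
    have h2 : b * (ε₀ ^ (σ - 1 / 2) - ε ^ (σ - 1 / 2)) / (σ - 1 / 2)
        ≤ b * ε₀ ^ (σ - 1 / 2) / (σ - 1 / 2) := by
      have : 0 ≤ ε ^ (σ - 1 / 2) := Real.rpow_nonneg hε.1.le _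
      gcongr
      linarith
    have h3 : 0 ≤ φ ε := hsw.trans (hφw ε hε)
    have h4 : k * (ε₀ - ε) ≤ k * ε₀ := mul_le_mul_of_nonneg_left (by linarith [hε.1]) hk
    simp only [hB]
    gcongr
    simp only [hφ]
    linarith
  · simp only [sub_zero, hB, hφ, hw, sub_self, mul_zero, zero_div, add_zero, Real.exp_zero, mul_one]
    rwa [Real.sq_sqrt hω.le]
  · intro t ht heq
    have he := hmem t (Set.Ico_subset_Icc_self ht)
    set e := ε₀ - t with he'
    have h1 := hF' e he
    rw [heq] at h1
    rw [norm_neg]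
    refine h1.trans_le ?_
    have hwp : 0 < √(w e) := Real.sqrt_pos.2 (hwpos e he)
    have hφp : 0 < φ e := hwp.trans_le (hφw e he)
    have hexp : 1 ≤ Real.exp (k * (ε₀ - e)) :=
      Real.one_le_exp (mul_nonneg hk (by linarith [he.2]))
    have hep : 0 < e := he.1
    set x := Real.exp (k * (ε₀ - e)) with hx
    -- The exponential x is at least 1, so √x ≤ x.
    have h2 : √(B e) ≤ φ e * x := by
      rw [Real.sqrt_le_left (by positivity)]
      simp only [hB]
      rw [mul_pow]
      gcongr
      nlinarith
    have hea : 0 ≤ e ^ (σ - 1) := Real.rpow_nonneg hep.le _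
    have heb : 0 ≤ e ^ (σ - 3 / 2) := Real.rpow_nonneg hep.le _
    have h3 : c * e ^ (σ - 1) ≤ φ e / √(w e) * (c * e ^ (σ - 1)) * x := by
      have h4 : 1 ≤ φ e / √(w e) := (one_le_div hwp).2 (hφw e he)
      have h5 : 1 ≤ φ e / √(w e) * x := one_le_mul_of_one_le_of_one_le h4 hexp
      have h6 := mul_le_mul_of_nonneg_left h5 (mul_nonneg hc hea)
      linarith
    have h4 : 2 * b * e ^ (σ - 3 / 2) * √(B e) ≤ 2 * b * e ^ (σ - 3 / 2) * (φ e * x) := by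
      gcongr
    have e1 : -(2 * φ e * (-(c * e ^ (σ - 1)) / (2 * √(w e)) - b * e ^ (σ - 3 / 2)) * x - k * B e)
        = φ e / √(w e) * (c * e ^ (σ - 1)) * x + 2 * b * e ^ (σ - 3 / 2) * (φ e * x) + k * B e := by
      field_simp
      ring
    rw [e1]
    linarith

end Gronwall

end Mourre

namespace Mourre

open Filter Topology Complex

/-! ### The deformed resolvent: invertibility, a priori bounds and derivative. -/

section Energy

variable {E : Type*} [NormedAddCommGroup E] [InnerProductSpace ℂ E] [CompleteSpace E]
  {A : E →ₗ.[ℂ] E}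

/-! ### Energy estimates for the deformed resolvent -/

/-- The deformation `H - z - iεB`, where `B = iC`. -/
noncomputable def deformed (H C : E →L[ℂ] E) (z : ℂ) (ε : ℝ) : E →L[ℂ] E :=
  H - z • (1 : E →L[ℂ] E) + (ε : ℂ) • C

/-- The inverse of the deformation `H - z - iεB`. -/
noncomputable def deformedResolvent (H C : E →L[ℂ] E) (z : ℂ) (ε : ℝ) : E →L[ℂ] E :=
  Ring.inverse (deformed H C z ε)

/-- The lower bound for T gives injectivity and closed range; the one for its adjoint gives dense
range. -/
theorem isUnit_of_norm_sq_le {T : E →L[ℂ] E} {K : ℝ} (h : ∀ y, ‖y‖ ^ 2 ≤ K * ‖T y‖ ^ 2)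
    (h' : ∀ y, ‖y‖ ^ 2 ≤ K * ‖star T y‖ ^ 2) : IsUnit T := by
  rw [ContinuousLinearMap.isUnit_iff_bijective,
    ContinuousLinearMap.bijective_iff_dense_range_and_antilipschitz]
  constructor
  · rw [Submodule.topologicalClosure_eq_top_iff, ContinuousLinearMap.orthogonal_range,
      ← ContinuousLinearMap.star_eq_adjoint, LinearMap.ker_eq_bot']
    intro y hy
    change star T y = 0 at hy
    have h1 := h' y
    rw [hy, norm_zero] at h1
    have h2 : ‖y‖ ^ 2 ≤ 0 := by simpa using h1
    exact norm_eq_zero.1 (pow_eq_zero_iff two_ne_zero |>.1 (le_antisymm h2 (sq_nonneg _)))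
  · refine ⟨_, ContinuousLinearMap.antilipschitz_of_bound T (K := Real.toNNReal √|K|) fun y => ?_⟩
    rw [Real.coe_toNNReal _ (Real.sqrt_nonneg _)]
    refine (sq_le_sq₀ (norm_nonneg _) (by positivity)).1 ?_
    rw [mul_pow, Real.sq_sqrt (abs_nonneg _)]
    exact (h y).trans (mul_le_mul_of_nonneg_right (le_abs_self K) (sq_nonneg _))

theorem isUnit_sub_smul_one {H : E →L[ℂ] E} (hH : IsSelfAdjoint H) {z : ℂ} (hz : z.im ≠ 0) :
    IsUnit (H - z • (1 : E →L[ℂ] E)) := by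
  by_contra h
  have h1 : z ∈ spectrum ℂ H := fun h2 => h (by
    have h2 : IsUnit (algebraMap ℂ (E →L[ℂ] E) z - H) := h2
    rw [Algebra.algebraMap_eq_smul_one] at h2
    simpa using h2.neg)
  exact hz (hH.im_eq_zero_of_mem_spectrum h1)

/-- The data of a Mourre estimate, in the form in which it enters the energy estimates. -/
structure EnergyData (H C : E →L[ℂ] E) (a κ lam μ ε₀ : ℝ) : Prop where
  selfAdjoint : IsSelfAdjoint H
  star_eq : star C = -C
  a_pos : 0 < a
  κ_nonneg : 0 ≤ κ
  μ_pos : 0 < μ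
  mourre : ∀ y, a / 2 * ‖y‖ ^ 2 ≤ (⟪y, (I • C) y⟫_ℂ).re + κ * ‖H y - (lam : ℂ) • y‖ ^ 2
  small : 2 * κ * ε₀ ^ 2 * ‖C‖ ^ 2 ≤ a / 10

variable {H C : E →L[ℂ] E} {a κ lam μ ε₀ : ℝ}

theorem inner_im_eq_zero {T : E →L[ℂ] E} (hT : IsSelfAdjoint T) (y : E) :
    (⟪y, T y⟫_ℂ).im = 0 := by
  rw [ContinuousLinearMap.isSelfAdjoint_iff_isSymmetric] at hT
  have h := hT y y
  rw [← inner_conj_symm] at h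
  exact Complex.conj_eq_iff_im.1 h

/-- The sign s = 1 is the deformation, s = -1 its adjoint. In Im⟪y, x⟫ the contributions of μ and of
εB carry the same sign, so the former can be dropped whatever the size of μ; this makes all later
bounds uniform in μ. -/
theorem EnergyData.le_norm_inner (hd : EnergyData H C a κ lam μ ε₀) {ε : ℝ}
    (hε : ε ∈ Set.Ioc 0 ε₀) {s : ℝ} (hs : s = 1 ∨ s = -1) {x y : E}
    (hx : x = H y - (lam : ℂ) • y - (I * (s * μ : ℝ)) • y + ((s * ε : ℝ) : ℂ) • C y) :
    2 * a / 5 * ε * ‖y‖ ^ 2 ≤ ‖⟪y, x⟫_ℂ‖ + 2 * κ * ε * ‖x‖ ^ 2 := by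
  have ha := hd.a_pos
  have hκ := hd.κ_nonneg
  have hε0 := hε.1
  have hs2 : |s| = 1 := by rcases hs with h | h <;> simp [h]
  set u := H y - (lam : ℂ) • y with hu
  have hB : IsSelfAdjoint (I • C) := by
    rw [isSelfAdjoint_iff, star_smul, hd.star_eq]; simp
  set b := (⟪y, (I • C) y⟫_ℂ).re with hb
  have hbC : ⟪y, (I • C) y⟫_ℂ = b :=
    Complex.ext (by rw [Complex.ofReal_re]) (by rw [inner_im_eq_zero hB, Complex.ofReal_im])
  have hyy : ⟪y, y⟫_ℂ = (‖y‖ ^ 2 : ℝ) := by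
    rw [inner_self_eq_norm_sq_to_K]; push_cast; rfl
  have hui : (⟪y, u⟫_ℂ).im = 0 := by
    rw [hu, inner_sub_right, inner_smul_right, Complex.sub_im, inner_im_eq_zero hd.selfAdjoint, hyy,
      ← Complex.ofReal_mul, Complex.ofReal_im, sub_zero]
  have hCy : C y = -(I • (I • C) y) := by
    rw [smul_apply, smul_smul, I_mul_I, neg_smul, one_smul, neg_neg]
  -- the imaginary part of `⟪y, x⟫`
  have him : (⟪y, x⟫_ℂ).im = -(s * (μ * ‖y‖ ^ 2 + ε * b)) := by
    rw [hx, hCy, inner_add_right, inner_sub_right, inner_smul_right, inner_smul_right,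
      inner_neg_right, inner_smul_right, hbC, hyy, Complex.add_im, Complex.sub_im, hui]
    simp only [mul_im, I_re, I_im, ofReal_re, ofReal_im, neg_im, mul_re]
    ring
  have h1 : ε * b ≤ ‖⟪y, x⟫_ℂ‖ := by
    have h2 := Complex.abs_im_le_norm (⟪y, x⟫_ℂ)
    rw [him, abs_neg, abs_mul, hs2, one_mul] at h2
    have h3 : 0 ≤ μ * ‖y‖ ^ 2 := mul_nonneg hd.μ_pos.le (sq_nonneg _)
    linarith [le_abs_self (μ * ‖y‖ ^ 2 + ε * b)]
  -- the part of `y` away from the energy `lam`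
  have h2 : ‖u‖ ≤ ‖u - (I * (s * μ : ℝ)) • y‖ := by
    refine (sq_le_sq₀ (norm_nonneg _) (norm_nonneg _)).1 ?_
    have h3 : (⟪u, (I * (s * μ : ℝ)) • y⟫_ℂ).re = 0 := by
      have h4 : (⟪u, y⟫_ℂ).im = 0 := by rw [← inner_conj_symm, Complex.conj_im, hui, neg_zero]
      rw [inner_smul_right]
      simp [h4]
    rw [norm_sub_sq (𝕜 := ℂ) u, RCLike.re_to_complex, h3]
    nlinarith [sq_nonneg ‖(I * ((s * μ : ℝ) : ℂ)) • y‖]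
  have h3 : ‖u - (I * (s * μ : ℝ)) • y‖ ≤ ‖x‖ + ε * ‖C‖ * ‖y‖ := by
    have e : u - (I * (s * μ : ℝ)) • y = x - ((s * ε : ℝ) : ℂ) • C y := by rw [hx]; abel
    rw [e]
    refine (norm_sub_le _ _).trans ?_
    rw [norm_smul, Complex.norm_real, Real.norm_eq_abs, abs_mul, hs2, one_mul, abs_of_pos hε0,
      mul_assoc]
    gcongr
    exact C.le_opNorm y
  have h4 : ‖u‖ ^ 2 ≤ 2 * ‖x‖ ^ 2 + 2 * (ε * ‖C‖ * ‖y‖) ^ 2 := by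
    have h5 := pow_le_pow_left₀ (norm_nonneg u) (h2.trans h3) 2
    nlinarith [sq_nonneg (‖x‖ - ε * ‖C‖ * ‖y‖)]
  have h5 := hd.mourre y
  -- Replacing (H - λ)y by x costs a/10 by the smallness of ε₀; this leaves a/2 - a/10 = 2a/5.
  have h6 : κ * ‖u‖ ^ 2 ≤ 2 * κ * ‖x‖ ^ 2 + a / 10 * ‖y‖ ^ 2 := by
    have h7 : ε ^ 2 ≤ ε₀ ^ 2 := pow_le_pow_left₀ hε0.le hε.2 2
    have h8 : 2 * κ * ε ^ 2 * ‖C‖ ^ 2 * ‖y‖ ^ 2 ≤ a / 10 * ‖y‖ ^ 2 :=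
      mul_le_mul_of_nonneg_right (le_trans (by gcongr) hd.small) (sq_nonneg _)
    have h9 := mul_le_mul_of_nonneg_left h4 hκ
    linarith
  have h7 : 2 * a / 5 * ‖y‖ ^ 2 ≤ b + 2 * κ * ‖x‖ ^ 2 := by linarith
  have h8 := mul_le_mul_of_nonneg_left h7 hε0.le
  linarith

omit [CompleteSpace E] in
theorem deformed_apply (z : ℂ) (ε : ℝ) (y : E) (hz : z = lam + I * μ) :
    deformed H C z ε y = H y - (lam : ℂ) • y - (I * (1 * μ : ℝ)) • y + ((1 * ε : ℝ) : ℂ) • C y := by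
  simp only [deformed, add_apply, sub_apply, smul_apply, one_apply_eq_self, hz, one_mul, add_smul]
  abel

theorem EnergyData.star_deformed_apply (hd : EnergyData H C a κ lam μ ε₀) (z : ℂ) (ε : ℝ) (y : E)
    (hz : z = lam + I * μ) : star (deformed H C z ε) y
      = H y - (lam : ℂ) • y - (I * (-1 * μ : ℝ)) • y + ((-1 * ε : ℝ) : ℂ) • C y := by
  have h : star (deformed H C z ε) = H - star z • (1 : E →L[ℂ] E) - (ε : ℂ) • C := by
    rw [deformed, star_add, star_sub, star_smul, star_smul, hd.star_eq, hd.selfAdjoint.star_eq,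
      star_one, Complex.star_def, Complex.conj_ofReal, smul_neg, ← sub_eq_add_neg]
  rw [h, hz]
  simp only [sub_apply, smul_apply, add_apply, neg_apply, one_apply_eq_self, Complex.star_def, map_add, map_mul, conj_I,
    conj_ofReal, neg_mul, one_mul, ofReal_neg, mul_neg, neg_smul, add_smul]
  abel

theorem EnergyData.isUnit (hd : EnergyData H C a κ lam μ ε₀) {z : ℂ} (hz : z = lam + I * μ)
    {ε : ℝ} (hε : ε ∈ Set.Ioc 0 ε₀) : IsUnit (deformed H C z ε) := by
  have ha := hd.a_pos
  have hκ := hd.κ_nonneg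
  have hε0 := hε.1
  have key : ∀ x y : E, 2 * a / 5 * ε * ‖y‖ ^ 2 ≤ ‖⟪y, x⟫_ℂ‖ + 2 * κ * ε * ‖x‖ ^ 2 →
      ‖y‖ ^ 2 ≤ 2 / (2 * a / 5 * ε) * (2 * κ * ε + 1 / (2 * (2 * a / 5 * ε))) * ‖x‖ ^ 2 := by
    intro x y h
    have hm : 0 < 2 * a / 5 * ε := by positivity
    set m := 2 * a / 5 * ε with hm'
    have h1 := norm_inner_le_norm (𝕜 := ℂ) y x
    have h2 : ‖y‖ * ‖x‖ ≤ m / 2 * ‖y‖ ^ 2 + 1 / (2 * m) * ‖x‖ ^ 2 := by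
      have e : m / 2 * ‖y‖ ^ 2 + 1 / (2 * m) * ‖x‖ ^ 2 - ‖y‖ * ‖x‖
          = 1 / (2 * m) * (m * ‖y‖ - ‖x‖) ^ 2 := by field_simp; ring
      have : 0 ≤ 1 / (2 * m) * (m * ‖y‖ - ‖x‖) ^ 2 := by positivity
      linarith
    have h3 : m / 2 * ‖y‖ ^ 2 ≤ (2 * κ * ε + 1 / (2 * m)) * ‖x‖ ^ 2 := by linarith
    have h4 := mul_le_mul_of_nonneg_left h3 (by positivity : 0 ≤ 2 / m)
    have e : 2 / m * (m / 2 * ‖y‖ ^ 2) = ‖y‖ ^ 2 := by field_simp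
    rw [e] at h4
    linarith
  exact isUnit_of_norm_sq_le
    (fun y => key _ y (hd.le_norm_inner hε (Or.inl rfl) (deformed_apply z ε y hz)))
    (fun y => key _ y (hd.le_norm_inner hε (Or.inr rfl) (hd.star_deformed_apply z ε y hz)))

/-- The bound for the half-weighted resolvent in terms of the weighted resolvent. -/
theorem EnergyData.norm_sq_le (hd : EnergyData H C a κ lam μ ε₀) {z : ℂ} (hz : z = lam + I * μ)
    {ε : ℝ} (hε : ε ∈ Set.Ioc 0 ε₀) {D : E →L[ℂ] E} (hD : IsSelfAdjoint D) (hD1 : ‖D‖ ≤ 1) (x : E) :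
    ‖deformedResolvent H C z ε (D x)‖ ≤
        √(5 / (2 * a) * (‖D * deformedResolvent H C z ε * D‖ / ε + 2 * κ)) * ‖x‖ ∧
      ‖star (deformedResolvent H C z ε) (D x)‖ ≤
        √(5 / (2 * a) * (‖D * deformedResolvent H C z ε * D‖ / ε + 2 * κ)) * ‖x‖ := by
  have ha := hd.a_pos
  have hκ := hd.κ_nonneg
  have hε0 := hε.1
  have hu := hd.isUnit hz hε
  set G := deformedResolvent H C z ε with hG
  set T := deformed H C z ε with hT
  have hTG : T * G = 1 := Ring.mul_inverse_cancel _ hu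
  have hGT : G * T = 1 := Ring.inverse_mul_cancel _ hu
  have hsymm : ∀ v w, ⟪v, D w⟫_ℂ = ⟪D v, w⟫_ℂ := fun v w =>
    ((ContinuousLinearMap.isSelfAdjoint_iff_isSymmetric.1 hD) v w).symm
  have hDx : ‖D x‖ ≤ ‖x‖ := by
    simpa using D.le_of_opNorm_le hD1 x
  have key : ∀ y, 2 * a / 5 * ε * ‖y‖ ^ 2 ≤ ‖⟪y, D x⟫_ℂ‖ + 2 * κ * ε * ‖D x‖ ^ 2 →
      ‖⟪y, D x⟫_ℂ‖ ≤ ‖D * G * D‖ * ‖x‖ ^ 2 →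
      ‖y‖ ≤ √(5 / (2 * a) * (‖D * G * D‖ / ε + 2 * κ)) * ‖x‖ := by
    intro y h1 h2
    refine (sq_le_sq₀ (norm_nonneg _) (by positivity)).1 ?_
    rw [mul_pow, Real.sq_sqrt (by positivity)]
    have h3 : 2 * κ * ε * ‖D x‖ ^ 2 ≤ 2 * κ * ε * ‖x‖ ^ 2 := by gcongr
    have h4 : 2 * a / 5 * ε * ‖y‖ ^ 2 ≤ (‖D * G * D‖ + 2 * κ * ε) * ‖x‖ ^ 2 := by linarith
    have h5 := mul_le_mul_of_nonneg_left h4 (by positivity : 0 ≤ 5 / (2 * a) / ε)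
    have e1 : 5 / (2 * a) / ε * (2 * a / 5 * ε * ‖y‖ ^ 2) = ‖y‖ ^ 2 := by field_simp
    have e2 : 5 / (2 * a) / ε * ((‖D * G * D‖ + 2 * κ * ε) * ‖x‖ ^ 2)
        = 5 / (2 * a) * (‖D * G * D‖ / ε + 2 * κ) * ‖x‖ ^ 2 := by field_simp
    rwa [e1, e2] at h5
  have hF : ∀ v : E, ‖⟪v, (D * G * D) v⟫_ℂ‖ ≤ ‖D * G * D‖ * ‖v‖ ^ 2 := fun v => by
    have h1 := norm_inner_le_norm (𝕜 := ℂ) v ((D * G * D) v)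
    have h2 := mul_le_mul_of_nonneg_left ((D * G * D).le_opNorm v) (norm_nonneg v)
    linarith
  constructor
  · refine key _ ?_ ?_
    · have e : D x = T (G (D x)) := by rw [← mul_apply_eq_comp, hTG]; rfl
      exact hd.le_norm_inner hε (Or.inl rfl)
        (e.trans (deformed_apply z ε _ hz))
    · rw [hsymm, norm_inner_symm]
      exact hF x
  · refine key _ ?_ ?_
    · have e : D x = star T (star G (D x)) := by
        rw [← mul_apply_eq_comp, ← star_mul, hGT, star_one]; rfl
      exact hd.le_norm_inner hε (Or.inr rfl)
        (e.trans (hd.star_deformed_apply z ε _ hz))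
    · rw [ContinuousLinearMap.star_eq_adjoint, ContinuousLinearMap.adjoint_inner_left, ← hsymm]
      exact hF x

/-- The starting value for Gronwall. With X = aε‖Gx‖, coercivity reads (2/5)X² ≤ X‖x‖ + ‖x‖²/256;
without the last term X ≤ 2.5‖x‖, and 2.51 covers the perturbation. -/
theorem EnergyData.norm_weighted_le (hd : EnergyData H C a κ lam μ ε₀) {z : ℂ}
    (hz : z = lam + I * μ) {ε : ℝ} (hε : ε ∈ Set.Ioc 0 ε₀) {D : E →L[ℂ] E} (hD1 : ‖D‖ ≤ 1)
    (hκ : 2 * κ * a * ε ^ 2 ≤ 1 / 256) :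
    ‖D * deformedResolvent H C z ε * D‖ ≤ 2.51 / (a * ε) := by
  have ha := hd.a_pos
  have hε0 := hε.1
  have hu := hd.isUnit hz hε
  set G := deformedResolvent H C z ε with hG
  have hTG : deformed H C z ε * G = 1 := Ring.mul_inverse_cancel _ hu
  have hG1 : ‖G‖ ≤ 2.51 / (a * ε) := by
    refine ContinuousLinearMap.opNorm_le_bound _ (by positivity) fun x => ?_
    have e : x = deformed H C z ε (G x) := by rw [← mul_apply_eq_comp, hTG]; rfl
    have h1 := hd.le_norm_inner hε (Or.inl rfl) (e.trans (deformed_apply z ε _ hz))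
    have h2 := norm_inner_le_norm (𝕜 := ℂ) (G x) x
    rw [div_mul_eq_mul_div, le_div_iff₀ (by positivity)]
    by_contra! hc
    have hX := norm_nonneg x
    set X := ‖G x‖ * (a * ε) with hXdef
    have h3 : 2 / 5 * X ^ 2 ≤ X * ‖x‖ + 1 / 256 * ‖x‖ ^ 2 := by
      have h4 : 2 * a / 5 * ε * ‖G x‖ ^ 2 ≤ ‖G x‖ * ‖x‖ + 2 * κ * ε * ‖x‖ ^ 2 := by linarith
      have h5 := mul_le_mul_of_nonneg_left h4 (by positivity : 0 ≤ a * ε)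
      have h6 := mul_le_mul_of_nonneg_right hκ (sq_nonneg ‖x‖)
      have e1 : a * ε * (2 * a / 5 * ε * ‖G x‖ ^ 2) = 2 / 5 * X ^ 2 := by rw [hXdef]; ring
      have e2 : a * ε * (‖G x‖ * ‖x‖ + 2 * κ * ε * ‖x‖ ^ 2)
          = X * ‖x‖ + 2 * κ * a * ε ^ 2 * ‖x‖ ^ 2 := by rw [hXdef]; ring
      rw [e1, e2] at h5
      linarith
    nlinarith
  have hG0 := norm_nonneg G
  calc ‖D * G * D‖ ≤ ‖D‖ * ‖G‖ * ‖D‖ :=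
        (norm_mul_le _ _).trans (mul_le_mul_of_nonneg_right (norm_mul_le _ _) (norm_nonneg _))
    _ ≤ 1 * ‖G‖ * 1 := by gcongr
    _ ≤ _ := by simpa using hG1

theorem hasDerivAt_deformed (z : ℂ) (ε : ℝ) : HasDerivAt (deformed H C z) C ε := by
  have h1 : HasDerivAt (fun e : ℝ => (e : ℂ) • C) ((1 : ℂ) • C) ε :=
    (Complex.ofRealCLM.hasDerivAt (x := ε)).smul_const C
  rw [one_smul] at h1
  exact h1.const_add _

theorem hasDerivAt_deformedResolvent {z : ℂ} {ε : ℝ} (hu : IsUnit (deformed H C z ε)) :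
    HasDerivAt (deformedResolvent H C z)
      (-(deformedResolvent H C z ε * C * deformedResolvent H C z ε)) ε := by
  obtain ⟨u, hu⟩ := hu
  have h1 := (hasFDerivAt_ringInverse (𝕜 := ℂ) u).restrictScalars ℝ
  rw [hu] at h1
  have h2 := h1.comp_hasDerivAt ε (hasDerivAt_deformed (H := H) (C := C) z ε)
  refine h2.congr_deriv ?_
  have h3 : deformedResolvent H C z ε = ↑u⁻¹ := by rw [deformedResolvent, ← hu, Ring.inverse_unit]
  rw [h3]
  rfl

/-- The commutator identity for the deformed resolvent, as an estimate. -/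
theorem norm_inner_deformedResolvent_le (hA : IsSelfAdjoint A) {C₂ : E →L[ℂ] E}
    (hC : IsCommutator A H C) (hC₂ : IsCommutator A C C₂) {z : ℂ} {ε : ℝ}
    (hu : IsUnit (deformed H C z ε)) {φ φ' ψ ψ' : E} (hφ : (φ, φ') ∈ A.graph)
    (hψ : (ψ, ψ') ∈ A.graph) :
    ‖⟪φ, (deformedResolvent H C z ε * (C + (ε : ℂ) • C₂) * deformedResolvent H C z ε) ψ⟫_ℂ‖ ≤
      ‖φ'‖ * ‖deformedResolvent H C z ε ψ‖ + ‖star (deformedResolvent H C z ε) φ‖ * ‖ψ'‖ := by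
  set G := deformedResolvent H C z ε with hG
  -- Inverting, G has derivative iG(C + εC₂)G. As a form on D(A) this is i times ⟪Aφ, Gψ⟫ - ⟪φ,
  -- GAψ⟫: an expression quadratic in G becomes linear in G.
  have hT : HasConjugateDeriv A (deformed H C z ε) (-(I • (C + (ε : ℂ) • C₂))) := by
    have h1 := ((isCommutator_iff.1 hC).add ((HasConjugateDeriv.one hA).smul (-z))).add
      ((isCommutator_iff.1 hC₂).smul (ε : ℂ))
    convert h1 using 1
    · rw [deformed, neg_smul, sub_eq_add_neg]
    · rw [smul_zero, add_zero, smul_add, neg_add, smul_neg, smul_comm I]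
  have hGd := hT.inverse hA (Ring.mul_inverse_cancel _ hu) (Ring.inverse_mul_cancel _ hu)
  have h1 := hGd.inner_eq hA hφ hψ
  have e : -(Ring.inverse (deformed H C z ε) * -(I • (C + (ε : ℂ) • C₂))
      * Ring.inverse (deformed H C z ε)) = I • (G * (C + (ε : ℂ) • C₂) * G) := by
    rw [mul_neg, neg_mul, neg_neg, mul_smul_comm, smul_mul_assoc]
    rfl
  rw [e, smul_apply, inner_smul_right] at h1
  rw [mul_left_cancel₀ I_ne_zero h1]
  refine (norm_sub_le _ _).trans (add_le_add (norm_inner_le_norm _ _) ?_)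
  have h2 : ⟪φ, G ψ'⟫_ℂ = ⟪star G φ, ψ'⟫_ℂ := by
    rw [ContinuousLinearMap.star_eq_adjoint, ContinuousLinearMap.adjoint_inner_left]
  change ‖⟪φ, G ψ'⟫_ℂ‖ ≤ _
  rw [h2]
  exact norm_inner_le_norm _ _

/-- The derivative of the weighted deformed resolvent. -/
theorem EnergyData.exists_hasDerivAt_weighted (hd : EnergyData H C a κ lam μ ε₀)
    (hA : IsSelfAdjoint A) {C₂ : E →L[ℂ] E} (hC : IsCommutator A H C) (hC₂ : IsCommutator A C C₂)
    {z : ℂ} (hz : z = lam + I * μ) {ε : ℝ} (hε : ε ∈ Set.Ioc 0 ε₀) {D : ℝ → E →L[ℂ] E}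
    {D' : E →L[ℂ] E} (hDd : HasDerivAt D D' ε) (hDsa : IsSelfAdjoint (D ε)) (hD1 : ‖D ε‖ ≤ 1) {d l : ℝ} (hd' : ‖D'‖ ≤ d)
    (hl : ∀ x, ∃ w, (D ε x, w) ∈ A.graph ∧ ‖w‖ ≤ l * ‖x‖) (hl0 : 0 ≤ l) :
    ∃ F', HasDerivAt (fun e => D e * deformedResolvent H C z e * D e) F' ε ∧
      ‖F'‖ ≤ 2 * (d + l) *
          √(5 / (2 * a) * (‖D ε * deformedResolvent H C z ε * D ε‖ / ε + 2 * κ))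
        + ε * ‖C₂‖ *
          (5 / (2 * a) * (‖D ε * deformedResolvent H C z ε * D ε‖ / ε + 2 * κ)) := by
  have ha := hd.a_pos
  have hκ := hd.κ_nonneg
  have hε0 := hε.1
  have hu := hd.isUnit hz hε
  have hbd := hd.norm_sq_le hz hε hDsa hD1
  have hder := (hDd.mul (hasDerivAt_deformedResolvent hu)).mul hDd
  refine ⟨_, hder, ?_⟩
  set G := deformedResolvent H C z ε with hG
  set D₀ := D ε with hD₀
  have hd0 : 0 ≤ d := (norm_nonneg _).trans hd'
  set r := 5 / (2 * a) * (‖D₀ * G * D₀‖ / ε + 2 * κ) with hr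
  have hr0 : 0 ≤ r := by positivity
  set g := √r with hg
  have hg0 : 0 ≤ g := Real.sqrt_nonneg _
  have hgg : g * g = r := Real.mul_self_sqrt hr0
  refine ContinuousLinearMap.opNorm_le_of_re_inner_le (𝕜 := ℂ) (by positivity) fun x y hx hy => ?_
  rw [inner_re_symm]
  refine (Complex.re_le_norm _).trans ?_
  obtain ⟨ψ', hψ, hψn⟩ := hl x
  obtain ⟨φ', hφ, hφn⟩ := hl y
  obtain ⟨hx1, -⟩ := hbd x
  obtain ⟨-, hy2⟩ := hbd y
  rw [hx, mul_one] at hx1 hψn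
  rw [hy, mul_one] at hy2 hφn
  have hsymm : ∀ v w, ⟪v, D₀ w⟫_ℂ = ⟪D₀ v, w⟫_ℂ := fun v w =>
    ((ContinuousLinearMap.isSelfAdjoint_iff_isSymmetric.1 hDsa) v w).symm
  have hadj : ∀ v w, ⟪v, G w⟫_ℂ = ⟪star G v, w⟫_ℂ := fun v w => by
    rw [ContinuousLinearMap.star_eq_adjoint, ContinuousLinearMap.adjoint_inner_left]
  have hcomm := norm_inner_deformedResolvent_le hA hC hC₂ hu hφ hψ
  -- Adding and subtracting εC₂ completes the middle term to the commutator of G with A; the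
  -- correction carries a factor ε, which offsets the 1/ε in ‖G D₀‖².
  have e1 : (D' * G + D₀ * -(G * C * G)) * D₀ + (D₀ * G) * D' =
      D' * G * D₀ + D₀ * G * D' - D₀ * (G * (C + (ε : ℂ) • C₂) * G) * D₀
        + (ε : ℂ) • (D₀ * (G * C₂ * G) * D₀) := by
    simp only [mul_add, add_mul, mul_neg, neg_mul, mul_smul_comm, smul_mul_assoc, mul_assoc]
    abel
  have e2 : ⟪y, ((D' * G + D₀ * -(G * C * G)) * D₀ + (D₀ * G) * D') x⟫_ℂ
      = ⟪y, D' (G (D₀ x))⟫_ℂ + ⟪star G (D₀ y), D' x⟫_ℂ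
        - ⟪D₀ y, (G * (C + (ε : ℂ) • C₂) * G) (D₀ x)⟫_ℂ
        + ε * ⟪star G (D₀ y), C₂ (G (D₀ x))⟫_ℂ := by
    rw [e1, add_apply, sub_apply, add_apply, smul_apply, inner_add_right, inner_sub_right,
      inner_add_right, inner_smul_right]
    simp only [mul_apply_eq_comp]
    rw [hsymm y, hadj, hsymm y, hsymm y, hadj (D₀ y) (C₂ (G (D₀ x)))]
  have n1 : ‖⟪y, D' (G (D₀ x))⟫_ℂ‖ ≤ d * g := by
    refine (norm_inner_le_norm _ _).trans ?_
    rw [hy, one_mul]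
    exact (D'.le_opNorm _).trans (mul_le_mul hd' hx1 (norm_nonneg _) hd0)
  have n2 : ‖⟪star G (D₀ y), D' x⟫_ℂ‖ ≤ g * d := by
    refine (norm_inner_le_norm _ _).trans (mul_le_mul hy2 ?_ (norm_nonneg _) hg0)
    exact (D'.le_opNorm x).trans (by rwa [hx, mul_one])
  have n3 : ‖⟪D₀ y, (G * (C + (ε : ℂ) • C₂) * G) (D₀ x)⟫_ℂ‖ ≤ l * g + g * l :=
    hcomm.trans (add_le_add (mul_le_mul hφn hx1 (norm_nonneg _) hl0)
      (mul_le_mul hy2 hψn (norm_nonneg _) hg0))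
  have n4 : ‖(ε : ℂ) * ⟪star G (D₀ y), C₂ (G (D₀ x))⟫_ℂ‖ ≤ ε * (g * (‖C₂‖ * g)) := by
    rw [norm_mul, Complex.norm_real, Real.norm_of_nonneg hε0.le]
    gcongr
    refine (norm_inner_le_norm _ _).trans (mul_le_mul hy2 ?_ (norm_nonneg _) hg0)
    exact (C₂.le_opNorm _).trans (mul_le_mul_of_nonneg_left hx1 (norm_nonneg _))
  refine (congrArg norm e2).le.trans ?_
  refine (norm_add_le _ _).trans ((add_le_add_left (norm_sub_le _ _) _).trans ?_)
  refine (add_le_add_left (add_le_add_left (norm_add_le _ _) _) _).trans ?_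
  rw [← hgg]
  linarith

end Energy

end Mourre

namespace Mourre

open Filter Topology Complex

/-! ### Bookkeeping of the constants and the limit ε → 0. -/

section LimitingAbsorption

/-! ### Elementary inequalities between the constants -/

theorem sqrt_add_mul_le {p q x r t : ℝ} (hx : 0 ≤ x) (hr : 0 ≤ r) (ht : 0 ≤ t)
    (hpr : p ≤ r ^ 2) (hpq : p * q ≤ t ^ 2) : √(p * (x ^ 2 + q)) ≤ r * x + t := by
  rw [Real.sqrt_le_left (by positivity)]
  have h1 := mul_le_mul_of_nonneg_right hpr (sq_nonneg x)
  have h2 : 0 ≤ r * x * t := by positivity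
  nlinarith

/-- Matches the bound on F′ with the Gronwall hypothesis for b = c = k = c₃. Here X stands for
ε^(σ-1), f for ‖F‖ and q for 2κ. -/
theorem deriv_bound_lt {a N c₁ c₂ q ε f X : ℝ} (ha : 0 < a) (hN0 : 0 ≤ N) (hN : N ≤ c₁)
    (hc₂ : 0 < c₂) (ha2 : 2 / a ≤ c₂ ^ 2) (hq0 : 0 ≤ q) (hq : 8 / a * q ≤ c₂ ^ 2) (hε : 0 < ε)
    (hεX : ε ≤ X) (hf : 0 ≤ f) {d : ℝ} (hd : d ≤ X / 4) :
    2 * (d + X) * √(5 / (2 * a) * (f / ε + q)) + ε * N * (5 / (2 * a) * (f / ε + q)) <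
      (4 * c₂ + 2 * c₁ * c₂ ^ 2) * X + 2 * (4 * c₂ + 2 * c₁ * c₂ ^ 2) * (X / √ε) * √f
        + (4 * c₂ + 2 * c₁ * c₂ ^ 2) * f := by
  have hX : 0 < X := hε.trans_le hεX
  have hse : 0 < √ε := Real.sqrt_pos.2 hε
  set y := √f / √ε with hy
  have hy0 : 0 ≤ y := by positivity
  have hy2 : f / ε = y ^ 2 := by rw [hy, div_pow, Real.sq_sqrt hf, Real.sq_sqrt hε.le]
  have hp : 5 / (2 * a) ≤ (5 / 4 * c₂) ^ 2 := by
    have e : 5 / (2 * a) = 5 / 4 * (2 / a) := by field_simp; norm_num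
    rw [e]; nlinarith
  have hpq : 5 / (2 * a) * q ≤ c₂ ^ 2 := by
    have e : 5 / (2 * a) * q = 5 / 16 * (8 / a * q) := by field_simp; ring
    rw [e]
    have : 0 ≤ 8 / a * q := by positivity
    linarith
  have hc₁ : 0 ≤ c₁ := hN0.trans hN
  have h1 : √(5 / (2 * a) * (f / ε + q)) ≤ 5 / 4 * c₂ * y + c₂ := by
    rw [hy2]
    exact sqrt_add_mul_le hy0 (by positivity) hc₂.le hp hpq
  have h2 : 2 * (d + X) * √(5 / (2 * a) * (f / ε + q))
      ≤ 2 * (X / 4 + X) * (5 / 4 * c₂ * y + c₂) := by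
    gcongr
  have h3 : ε * N * (5 / (2 * a) * (f / ε + q)) ≤ 2 * c₁ * c₂ ^ 2 * f + c₁ * c₂ ^ 2 * X := by
    have e : ε * N * (5 / (2 * a) * (f / ε + q))
        = N * (5 / (2 * a)) * f + N * (5 / (2 * a) * q) * ε := by field_simp
    rw [e]
    have h4 : N * (5 / (2 * a)) ≤ c₁ * (5 / 4 * c₂) ^ 2 := by gcongr
    have h5 : N * (5 / (2 * a) * q) ≤ c₁ * c₂ ^ 2 := by gcongr
    have h6 : c₁ * (5 / 4 * c₂) ^ 2 ≤ 2 * c₁ * c₂ ^ 2 := by nlinarith [mul_nonneg hc₁ (sq_nonneg c₂)]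
    have h7 := mul_le_mul_of_nonneg_right (h4.trans h6) hf
    have h8 := mul_le_mul h5 hεX hε.le (by positivity)
    linarith
  have e : 2 * (4 * c₂ + 2 * c₁ * c₂ ^ 2) * (X / √ε) * √f
      = 8 * (c₂ * X * y) + 4 * (c₁ * c₂ ^ 2 * (X * y)) := by
    rw [hy]; field_simp; ring
  rw [e]
  have h4 : 0 ≤ c₂ * X * y := by positivity
  have h5 : 0 ≤ c₁ * c₂ ^ 2 * (X * y) := by positivity
  have h6 : 0 < c₂ * X := by positivity
  have h7 : 0 ≤ c₁ * c₂ ^ 2 * X := by positivity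
  have h8 : 0 ≤ c₂ * f := by positivity
  nlinarith

/-- The constants of the limiting absorption principle. -/
structure Constants (a δ nC N q c₁ c₂ ε₀ : ℝ) : Prop where
  a_pos : 0 < a
  δ_pos : 0 < δ
  N_nonneg : 0 ≤ N
  N_le : N ≤ c₁
  q_nonneg : 0 ≤ q
  q_le : q ≤ c₁ / δ ^ 2
  nC_sq_le : nC ^ 2 ≤ c₁
  a_le : a ≤ c₁
  one_le : 1 ≤ c₁
  δ_le : δ ≤ c₁
  c₂_eq : c₂ = √(2 / a) + 1 / δ * √(8 * c₁ / a)
  ε₀_eq : ε₀ = min (√a * δ / (4 * c₁)) (δ ^ 2 / (16 * c₁ ^ 2))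

namespace Constants

variable {a δ nC N q c₁ c₂ ε₀ : ℝ}

theorem c₁_pos (h : Constants a δ nC N q c₁ c₂ ε₀) : 0 < c₁ := one_pos.trans_le h.one_le

theorem ε₀_pos (h : Constants a δ nC N q c₁ c₂ ε₀) : 0 < ε₀ := by
  have := h.a_pos
  have := h.δ_pos
  have := h.c₁_pos
  rw [h.ε₀_eq]
  exact lt_min (by positivity) (by positivity)

theorem mul_ε₀_le (h : Constants a δ nC N q c₁ c₂ ε₀) : 16 * c₁ ^ 2 * ε₀ ≤ δ ^ 2 := by
  have := h.c₁_pos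
  have h1 : ε₀ ≤ δ ^ 2 / (16 * c₁ ^ 2) := h.ε₀_eq ▸ min_le_right _ _
  rw [le_div_iff₀ (by positivity)] at h1
  linarith

theorem mul_ε₀_sq_le (h : Constants a δ nC N q c₁ c₂ ε₀) : 16 * c₁ ^ 2 * ε₀ ^ 2 ≤ a * δ ^ 2 := by
  have := h.c₁_pos
  have h1 : ε₀ ≤ √a * δ / (4 * c₁) := h.ε₀_eq ▸ min_le_left _ _
  rw [le_div_iff₀ (by positivity)] at h1
  have h2 := pow_le_pow_left₀ (mul_nonneg h.ε₀_pos.le (by positivity)) h1 2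
  rw [mul_pow, mul_pow, mul_pow, Real.sq_sqrt h.a_pos.le] at h2
  linarith

/-- This is where δ ≤ c₁ enters, a fact which rests on the virial argument. -/
theorem ε₀_le (h : Constants a δ nC N q c₁ c₂ ε₀) : ε₀ ≤ 1 / 16 := by
  have h1 := h.mul_ε₀_le
  have h2 := pow_le_pow_left₀ h.δ_pos.le h.δ_le 2
  have h3 : 0 < c₁ ^ 2 := pow_pos h.c₁_pos 2
  have h4 : c₁ ^ 2 * (16 * ε₀) ≤ c₁ ^ 2 * 1 := by linarith
  have := le_of_mul_le_mul_left h4 h3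
  linarith

theorem c₂_pos (h : Constants a δ nC N q c₁ c₂ ε₀) : 0 < c₂ := by
  have := h.a_pos
  have := h.δ_pos
  rw [h.c₂_eq]
  have h1 : 0 < √(2 / a) := Real.sqrt_pos.2 (by positivity)
  positivity

theorem two_div_le (h : Constants a δ nC N q c₁ c₂ ε₀) : 2 / a ≤ c₂ ^ 2 := by
  have := h.a_pos
  have := h.δ_pos
  rw [← Real.sqrt_le_left h.c₂_pos.le, h.c₂_eq]
  have : 0 ≤ 1 / δ * √(8 * c₁ / a) := by positivity
  linarith

theorem mul_q_le (h : Constants a δ nC N q c₁ c₂ ε₀) : 8 / a * q ≤ c₂ ^ 2 := by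
  have ha := h.a_pos
  have hδ := h.δ_pos
  have hc := h.c₁_pos
  have h1 : 8 / a * q ≤ (1 / δ * √(8 * c₁ / a)) ^ 2 := by
    rw [mul_pow, Real.sq_sqrt (by positivity)]
    calc 8 / a * q ≤ 8 / a * (c₁ / δ ^ 2) := by gcongr; exact h.q_le
      _ = _ := by field_simp
  refine h1.trans (pow_le_pow_left₀ (by positivity) ?_ 2)
  rw [h.c₂_eq]
  exact le_add_of_nonneg_left (Real.sqrt_nonneg _)

theorem q_mul_ε₀_le (h : Constants a δ nC N q c₁ c₂ ε₀) : c₁ * q * ε₀ ≤ 1 / 16 := by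
  have hc := h.c₁_pos
  have hδ := h.δ_pos
  have h0 := h.ε₀_pos
  calc c₁ * q * ε₀ ≤ c₁ * (c₁ / δ ^ 2) * ε₀ := by gcongr; exact h.q_le
    _ = 16 * c₁ ^ 2 * ε₀ / (16 * δ ^ 2) := by field_simp
    _ ≤ δ ^ 2 / (16 * δ ^ 2) := by gcongr; exact h.mul_ε₀_le
    _ = 1 / 16 := by field_simp

theorem q_mul_a_le (h : Constants a δ nC N q c₁ c₂ ε₀) : q * a * ε₀ ^ 2 ≤ 1 / 256 := by
  have h0 := h.ε₀_pos
  have h1 : q * a * ε₀ ≤ 1 / 16 := by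
    calc q * a * ε₀ ≤ q * c₁ * ε₀ := by
          have := h.q_nonneg
          gcongr
          exact h.a_le
      _ = c₁ * q * ε₀ := by ring
      _ ≤ _ := h.q_mul_ε₀_le
  have h2 := h.ε₀_le
  have h3 := mul_le_mul h1 h2 h0.le (by norm_num)
  linarith

theorem small (h : Constants a δ nC N q c₁ c₂ ε₀) : q * ε₀ ^ 2 * nC ^ 2 ≤ a / 10 := by
  have ha := h.a_pos
  have hc := h.c₁_pos
  have hδ := h.δ_pos
  have hq := h.q_nonneg
  calc q * ε₀ ^ 2 * nC ^ 2 ≤ c₁ / δ ^ 2 * ε₀ ^ 2 * c₁ := by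
        gcongr
        · exact h.q_le
        · exact h.nC_sq_le
    _ = 16 * c₁ ^ 2 * ε₀ ^ 2 / (16 * δ ^ 2) := by field_simp
    _ ≤ a * δ ^ 2 / (16 * δ ^ 2) := div_le_div_of_nonneg_right h.mul_ε₀_sq_le (by positivity)
    _ = a / 16 := by field_simp
    _ ≤ a / 10 := by linarith

/-- The differential inequality with the sharper constants available for the weight `⟨A⟩⁻¹`. -/
theorem deriv_bound_one_lt (h : Constants a δ nC N q c₁ c₂ ε₀) {ε f : ℝ}
    (hε : ε ∈ Set.Ioc 0 ε₀) (hf : 0 ≤ f) :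
    2 * √(5 / (2 * a) * (f / ε + q)) + ε * N * (5 / (2 * a) * (f / ε + q)) <
      1 / (20 * a * ε₀ ^ 2) + 2 * √(5 / (2 * a)) * (1 / √ε) * √f
        + (4 * c₂ + 2 * c₁ * c₂ ^ 2) * f := by
  have ha := h.a_pos
  have hc := h.c₁_pos
  have hc2 := h.c₂_pos
  have hq0 := h.q_nonneg
  have hN0 := h.N_nonneg
  have hε0 := hε.1
  have h0 := h.ε₀_pos
  have hse : 0 < √ε := Real.sqrt_pos.2 hε0
  set y := √f / √ε with hy
  have hy0 : 0 ≤ y := by positivity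
  have hy2 : f / ε = y ^ 2 := by rw [hy, div_pow, Real.sq_sqrt hf, Real.sq_sqrt hε0.le]
  have h1 : √(5 / (2 * a) * (f / ε + q)) ≤ √(5 / (2 * a)) * y + 9 / 400 / (a * ε₀ ^ 2) := by
    rw [hy2]
    refine sqrt_add_mul_le hy0 (by positivity) (by positivity)
      (Real.sq_sqrt (by positivity)).ge ?_
    have e : (9 / 400 / (a * ε₀ ^ 2)) ^ 2
        = 81 / 160000 / (a ^ 2 * ε₀ ^ 4) := by field_simp; norm_num
    rw [e, le_div_iff₀ (by positivity)]
    have e2 : 5 / (2 * a) * q * (a ^ 2 * ε₀ ^ 4) = 5 / 2 * (q * a * ε₀ ^ 2) * ε₀ ^ 2 := by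
      field_simp
    rw [e2]
    have h2 := h.q_mul_a_le
    have h3 := pow_le_pow_left₀ h0.le h.ε₀_le 2
    have h4 : 5 / 2 * (q * a * ε₀ ^ 2) * ε₀ ^ 2 ≤ 5 / 2 * (1 / 256) * (1 / 16) ^ 2 := by
      gcongr
    linarith
  have h3 : ε * N * (5 / (2 * a) * (f / ε + q))
      ≤ 2 * c₁ * c₂ ^ 2 * f + 1 / 1000 / (a * ε₀ ^ 2) := by
    have e : ε * N * (5 / (2 * a) * (f / ε + q))
        = N * (5 / 4 * (2 / a)) * f + 5 / (2 * a) * (N * q * ε) := by field_simp; ring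
    rw [e]
    have h4 : N * (5 / 4 * (2 / a)) ≤ c₁ * (5 / 4 * c₂ ^ 2) := by
      gcongr
      · exact h.N_le
      · exact h.two_div_le
    have h5 : N * q * ε ≤ c₁ * q * ε₀ := by
      gcongr
      · exact h.N_le
      · exact hε.2
    have h6 : 5 / (2 * a) * (N * q * ε) ≤ 5 / (2 * a) * (1 / 16) := by
      gcongr
      exact h5.trans h.q_mul_ε₀_le
    have h7 : 5 / (2 * a) * (1 / 16) ≤ 1 / 1000 / (a * ε₀ ^ 2) := by
      rw [le_div_iff₀ (by positivity)]
      have e : 5 / (2 * a) * (1 / 16) * (a * ε₀ ^ 2) = 5 / 32 * ε₀ ^ 2 := by field_simp; norm_num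
      rw [e]
      have h3 := pow_le_pow_left₀ h0.le h.ε₀_le 2
      linarith
    have h8 := mul_le_mul_of_nonneg_right h4 hf
    have h9 : 0 ≤ c₁ * c₂ ^ 2 * f := by positivity
    linarith
  have e : 2 * √(5 / (2 * a)) * (1 / √ε) * √f = 2 * (√(5 / (2 * a)) * y) := by
    rw [hy]; field_simp
  have h4 : 0 < 1 / (a * ε₀ ^ 2) := by positivity
  have e1 : 9 / 400 / (a * ε₀ ^ 2) = 9 / 400 * (1 / (a * ε₀ ^ 2)) := by ring
  have e2 : 1 / 1000 / (a * ε₀ ^ 2) = 1 / 1000 * (1 / (a * ε₀ ^ 2)) := by ring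
  have e3 : 1 / (20 * a * ε₀ ^ 2) = 1 / 20 * (1 / (a * ε₀ ^ 2)) := by field_simp
  rw [e1] at h1
  rw [e2] at h3
  rw [e, e3]
  have h5 : 0 ≤ 4 * c₂ * f := by positivity
  linarith

/-- In units of (aε₀)^(-1/2): the first root is √(2.51 + 0.05) = 1.6, the second term is at most 0.4
because ε₀ ≤ 1/16, and the sum is 2 = √4. -/
theorem sqrt_add_le (h : Constants a δ nC N q c₁ c₂ ε₀) :
    √(2.51 / (a * ε₀) + 1 / (20 * a * ε₀ ^ 2) * ε₀ ^ (1 : ℝ) / 1)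
      + √(5 / (2 * a)) * ε₀ ^ ((1 : ℝ) - 1 / 2) / (1 - 1 / 2) ≤ √(4 / (a * ε₀)) := by
  have ha := h.a_pos
  have h0 := h.ε₀_pos
  set t := √(1 / (a * ε₀)) with ht
  have ht0 : 0 ≤ t := Real.sqrt_nonneg _
  have ht2 : t ^ 2 = 1 / (a * ε₀) := Real.sq_sqrt (by positivity)
  have h1 : √(2.51 / (a * ε₀) + 1 / (20 * a * ε₀ ^ 2) * ε₀ ^ (1 : ℝ) / 1) ≤ 1.6 * t := by
    rw [Real.sqrt_le_left (by positivity), mul_pow, ht2, Real.rpow_one]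
    have e : 2.51 / (a * ε₀) + 1 / (20 * a * ε₀ ^ 2) * ε₀ / 1 = 2.56 * (1 / (a * ε₀)) := by
      field_simp; norm_num
    rw [e]; norm_num
  have h2 : √(5 / (2 * a)) * ε₀ ^ ((1 : ℝ) - 1 / 2) / (1 - 1 / 2) ≤ 0.4 * t := by
    have e : ε₀ ^ ((1 : ℝ) - 1 / 2) = √ε₀ := by rw [Real.sqrt_eq_rpow]; norm_num
    rw [e, ← Real.sqrt_mul (by positivity)]
    have h3 : √(5 / (2 * a) * ε₀) ≤ 0.2 * t := by
      rw [Real.sqrt_le_left (by positivity), mul_pow, ht2]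
      have e : 0.2 ^ 2 * (1 / (a * ε₀)) = 0.04 / ε₀ ^ 2 * (1 / a * ε₀) := by field_simp; norm_num
      have e2 : 5 / (2 * a) * ε₀ = 5 / 2 * (1 / a * ε₀) := by field_simp
      rw [e, e2]
      refine mul_le_mul_of_nonneg_right ?_ (by positivity)
      rw [le_div_iff₀ (by positivity)]
      have h3 := pow_le_pow_left₀ h0.le h.ε₀_le 2
      norm_num at h3 ⊢
      linarith
    norm_num at h3 ⊢
    linarith
  have h3 : 2 * t ≤ √(4 / (a * ε₀)) := by
    refine Real.le_sqrt_of_sq_le ?_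
    rw [mul_pow, ht2]
    exact le_of_eq (by ring)
  linarith

end Constants

/-! ### The limiting absorption principle -/

variable {E : Type*} [NormedAddCommGroup E] [InnerProductSpace ℂ E] [CompleteSpace E]
  {A : E →ₗ.[ℂ] E} {H C C₂ S : E →L[ℂ] E} {a κ lam μ ε₀ : ℝ}

/-- For fixed μ > 0 both the weights and the deformed resolvent converge in norm as ε ↓ 0, so a
bound uniform in ε survives. -/
theorem EnergyData.norm_le_of_forall (hd : EnergyData H C a κ lam μ ε₀) (hA : IsSelfAdjoint A)
    (hS : IsInvOneAddSq A S) {z : ℂ} (hz : z = lam + I * μ) {σ : ℝ} (hσ : σ ≤ 1) (hσ0 : 0 < σ)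
    (hε₀ : 0 < ε₀) {M : ℝ} (hM : ∀ ε ∈ Set.Ioc 0 ε₀,
      ‖weight S σ ε * deformedResolvent H C z ε * weight S σ ε‖ ≤ M) :
    ‖cfc (fun s : ℝ => s ^ (σ / 2)) S * resolv H z * cfc (fun s : ℝ => s ^ (σ / 2)) S‖ ≤ M := by
  have hw := hS.tendsto_weight hA hσ hσ0
  have hu : IsUnit (H - z • (1 : E →L[ℂ] E)) := by
    refine isUnit_sub_smul_one hd.selfAdjoint ?_
    rw [hz]
    simpa using hd.μ_pos.ne'
  have hG : Tendsto (deformedResolvent H C z) (𝓝[>] 0) (𝓝 (resolv H z)) := by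
    obtain ⟨u, hu⟩ := hu
    have h1 := NormedRing.inverse_continuousAt u
    have h2 : Tendsto (deformed H C z) (𝓝[>] 0) (𝓝 u) := by
      have h3 := (hasDerivAt_deformed (H := H) (C := C) z 0).continuousAt.tendsto
      have h4 : deformed H C z 0 = u := by simp [deformed, hu]
      rw [h4] at h3
      exact h3.mono_left nhdsWithin_le_nhds
    have h3 : resolv H z = Ring.inverse (u : E →L[ℂ] E) := by rw [resolv, hu]
    rw [h3]
    exact h1.tendsto.comp h2
  refine le_of_tendsto ((hw.mul hG).mul hw).norm ?_
  filter_upwards [Ioc_mem_nhdsGT hε₀] with ε hε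
  exact hM ε hε

variable {δ c₁ c₂ : ℝ}

theorem EnergyData.norm_weighted_resolv_le_of_le_one (hd : EnergyData H C a κ lam μ ε₀)
    (hA : IsSelfAdjoint A) (hC : IsCommutator A H C) (hC₂ : IsCommutator A C C₂)
    (hS : IsInvOneAddSq A S) {z : ℂ} (hz : z = lam + I * μ)
    (hc : Constants a δ ‖C‖ ‖C₂‖ (2 * κ) c₁ c₂ ε₀) {ν : ℝ} (hν : 1 / 2 < ν) (hν1 : ν ≤ 1) :
    ‖cfc (fun s : ℝ => s ^ (ν / 2)) S * resolv H z * cfc (fun s : ℝ => s ^ (ν / 2)) S‖ ≤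
      (√(4 / (a * ε₀) + (4 * c₂ + 2 * c₁ * c₂ ^ 2) * ε₀ ^ ν / ν)
        + (4 * c₂ + 2 * c₁ * c₂ ^ 2) * ε₀ ^ (ν - 1 / 2) / (ν - 1 / 2)) ^ 2
        * Real.exp ((4 * c₂ + 2 * c₁ * c₂ ^ 2) * ε₀) := by
  have ha := hd.a_pos
  have h0 := hc.ε₀_pos
  have hc1 := hc.c₁_pos
  have hc2 := hc.c₂_pos
  refine hd.norm_le_of_forall hA hS hz hν1 (by linarith) h0 fun ε hε => ?_
  have hex : ∀ e ∈ Set.Ioc 0 ε₀, _ := fun e he =>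
    hd.exists_hasDerivAt_weighted hA hC hC₂ hz he (hS.hasDerivAt_weight hA ν he.1)
      (isSelfAdjoint_weight S ν e) (hS.norm_weight_le hA he.1 hν1 (by linarith))
      (hS.norm_weightDeriv_le hA he.1 hν1) (hS.exists_graph_weight hA he.1 hν1)
      (Real.rpow_nonneg he.1.le _)
  choose! F' hF' hF'n using hex
  refine norm_le_of_norm_deriv_lt_sqrt (F' := F') hν (by positivity) (by positivity)
    (by positivity) (by positivity) hF' (fun e he => ?_) ?_ hε
  · refine (hF'n e he).trans_lt ?_
    have he1 : e ≤ 1 := he.2.trans (hc.ε₀_le.trans (by norm_num))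
    have hX : e ≤ e ^ (ν - 1) := by
      have h1 : e ^ (1 : ℝ) ≤ e ^ (ν - 1) :=
        Real.rpow_le_rpow_of_exponent_ge he.1 he1 (by linarith)
      rwa [Real.rpow_one] at h1
    have hXh : e ^ (ν - 3 / 2) = e ^ (ν - 1) / √e := by
      rw [Real.sqrt_eq_rpow, ← Real.rpow_sub he.1]; congr 1; ring
    have hX0 : 0 ≤ e ^ (ν - 1) := Real.rpow_nonneg he.1.le _
    rw [hXh]
    -- The condition d ≤ X/4 is (1 - ν)/2 ≤ 1/4, that is, ν ≥ 1/2.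
    refine deriv_bound_lt ha (norm_nonneg _) hc.N_le hc2 hc.two_div_le hc.q_nonneg hc.mul_q_le he.1
      hX (norm_nonneg _) ?_
    nlinarith
  · have hmem : ε₀ ∈ Set.Ioc 0 ε₀ := ⟨h0, le_rfl⟩
    refine (hd.norm_weighted_le hz hmem (hS.norm_weight_le hA h0 hν1 (by linarith))
      hc.q_mul_a_le).trans ?_
    gcongr
    norm_num

theorem EnergyData.norm_weighted_resolv_one_le (hd : EnergyData H C a κ lam μ ε₀)
    (hA : IsSelfAdjoint A) (hC : IsCommutator A H C) (hC₂ : IsCommutator A C C₂)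
    (hS : IsInvOneAddSq A S) {z : ℂ} (hz : z = lam + I * μ)
    (hc : Constants a δ ‖C‖ ‖C₂‖ (2 * κ) c₁ c₂ ε₀) :
    ‖cfc (fun s : ℝ => s ^ ((1 : ℝ) / 2)) S * resolv H z * cfc (fun s : ℝ => s ^ ((1 : ℝ) / 2)) S‖ ≤
      4 / (a * ε₀) * Real.exp ((4 * c₂ + 2 * c₁ * c₂ ^ 2) * ε₀) := by
  have ha := hd.a_pos
  have h0 := hc.ε₀_pos
  have hc1 := hc.c₁_pos
  have hc2 := hc.c₂_pos
  refine hd.norm_le_of_forall hA hS hz le_rfl one_pos h0 fun ε hε => ?_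
  have hex : ∀ e ∈ Set.Ioc 0 ε₀, _ := fun e he =>
    hd.exists_hasDerivAt_weighted hA hC hC₂ hz he (hS.hasDerivAt_weight hA 1 he.1)
      (isSelfAdjoint_weight S 1 e) (hS.norm_weight_le hA he.1 le_rfl zero_le_one)
      (hS.norm_weightDeriv_le hA he.1 le_rfl) (hS.exists_graph_weight hA he.1 le_rfl)
      (Real.rpow_nonneg he.1.le _)
  choose! F' hF' hF'n using hex
  refine (norm_le_of_norm_deriv_lt_sqrt (F' := F') (σ := 1) (b := √(5 / (2 * a)))
    (c := 1 / (20 * a * ε₀ ^ 2)) (k := 4 * c₂ + 2 * c₁ * c₂ ^ 2) (ω := 2.51 / (a * ε₀))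
    (by norm_num) (by positivity) (by positivity)
    (by positivity) (by positivity) hF' (fun e he => ?_) ?_ hε).trans ?_
  · refine (hF'n e he).trans_lt ?_
    have hXh : e ^ ((1 : ℝ) - 3 / 2) = 1 / √e := by
      rw [Real.sqrt_eq_rpow, one_div, ← Real.rpow_neg he.1.le]; norm_num
    rw [hXh]
    -- For σ = 1 the weight S^(1/2) does not depend on ε: the derivative bound is d = 0 and the
    -- graph bound is l = 1.
    simpa using hc.deriv_bound_one_lt he (norm_nonneg _)
  · exact hd.norm_weighted_le hz ⟨h0, le_rfl⟩ (hS.norm_weight_le hA h0 le_rfl zero_le_one)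
      hc.q_mul_a_le
  · refine mul_le_mul_of_nonneg_right ?_ (Real.exp_nonneg _)
    have h1 := pow_le_pow_left₀ (add_nonneg (Real.sqrt_nonneg _) (by positivity))
      hc.sqrt_add_le 2
    rwa [Real.sq_sqrt (by positivity)] at h1

/-- For ν > 1 the surplus ⟨A⟩^(-(ν-1)) is a contraction on either side, and the sharp bound
4/(aε₀)·exp(c₃ε₀) at exponent 1 is dominated by the stated one, whose other terms are nonnegative.
-/
theorem EnergyData.norm_weighted_resolv_le (hd : EnergyData H C a κ lam μ ε₀)
    (hA : IsSelfAdjoint A) (hC : IsCommutator A H C) (hC₂ : IsCommutator A C C₂)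
    (hS : IsInvOneAddSq A S) {z : ℂ} (hz : z = lam + I * μ)
    (hc : Constants a δ ‖C‖ ‖C₂‖ (2 * κ) c₁ c₂ ε₀) {ν : ℝ} (hν : 1 / 2 < ν) :
    ‖cfc (fun s : ℝ => s ^ (ν / 2)) S * resolv H z * cfc (fun s : ℝ => s ^ (ν / 2)) S‖ ≤
      (√(4 / (a * ε₀) + (4 * c₂ + 2 * c₁ * c₂ ^ 2) * ε₀ ^ ν / ν)
        + (4 * c₂ + 2 * c₁ * c₂ ^ 2) * ε₀ ^ (ν - 1 / 2) / (ν - 1 / 2)) ^ 2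
        * Real.exp ((4 * c₂ + 2 * c₁ * c₂ ^ 2) * ε₀) := by
  rcases le_or_gt ν 1 with h | h
  · exact hd.norm_weighted_resolv_le_of_le_one hA hC hC₂ hS hz hc hν h
  have ha := hd.a_pos
  have h0 := hc.ε₀_pos
  have hc1 := hc.c₁_pos
  have hc2 := hc.c₂_pos
  have hsub := hS.spectrum_subset hA
  have hcont : ∀ r : ℝ, 0 < r → ContinuousOn (fun s : ℝ => s ^ r) (spectrum ℝ S) := fun r hr =>
    (Real.continuous_rpow_const hr.le).continuousOn
  set Q := cfc (fun s : ℝ => s ^ ((1 : ℝ) / 2)) S with hQ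
  set P := cfc (fun s : ℝ => s ^ ((ν - 1) / 2)) S with hP
  have hadd : ∀ s ∈ spectrum ℝ S, s ^ (ν / 2) = s ^ ((ν - 1) / 2) * s ^ ((1 : ℝ) / 2) :=
    fun s hs => by
      rw [← Real.rpow_add_of_nonneg (hsub hs).1 (by linarith) (by norm_num)]
      congr 1; ring
  have h1 : cfc (fun s : ℝ => s ^ (ν / 2)) S = P * Q := by
    rw [hP, hQ, ← cfc_mul _ _ S (hcont _ (by linarith)) (hcont _ (by norm_num))]
    exact cfc_congr hadd
  have h2 : P * Q = Q * P := cfc_commute_cfc _ _ S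
  have hP1 : ‖P‖ ≤ 1 := norm_cfc_le zero_le_one fun s hs => by
    obtain ⟨hs0, hs1⟩ := hsub hs
    rw [Real.norm_of_nonneg (by positivity)]
    exact Real.rpow_le_one hs0 hs1 (by linarith)
  have e : cfc (fun s : ℝ => s ^ (ν / 2)) S * resolv H z * cfc (fun s : ℝ => s ^ (ν / 2)) S
      = P * (Q * resolv H z * Q) * P := by
    rw [h1]
    nth_rewrite 2 [h2]
    simp only [mul_assoc]
  have hone := hd.norm_weighted_resolv_one_le hA hC hC₂ hS hz hc
  rw [e]
  calc ‖P * (Q * resolv H z * Q) * P‖ ≤ ‖P‖ * ‖Q * resolv H z * Q‖ * ‖P‖ :=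
        (norm_mul_le _ _).trans (mul_le_mul_of_nonneg_right (norm_mul_le _ _) (norm_nonneg _))
    _ ≤ 1 * ‖Q * resolv H z * Q‖ * 1 := by gcongr
    _ = ‖Q * resolv H z * Q‖ := by ring
    _ ≤ _ := hone
    _ ≤ _ := by
        have hs : 0 < ν - 1 / 2 := by linarith
        refine mul_le_mul_of_nonneg_right ?_ (Real.exp_nonneg _)
        have h3 : √(4 / (a * ε₀)) ≤ √(4 / (a * ε₀) + (4 * c₂ + 2 * c₁ * c₂ ^ 2) * ε₀ ^ ν / ν)
            + (4 * c₂ + 2 * c₁ * c₂ ^ 2) * ε₀ ^ (ν - 1 / 2) / (ν - 1 / 2) := by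
          have h4 : 0 ≤ (4 * c₂ + 2 * c₁ * c₂ ^ 2) * ε₀ ^ ν / ν := by positivity
          have h5 : 0 ≤ (4 * c₂ + 2 * c₁ * c₂ ^ 2) * ε₀ ^ (ν - 1 / 2) / (ν - 1 / 2) := by
            positivity
          have h6 := Real.sqrt_le_sqrt (le_add_of_nonneg_right h4 : 4 / (a * ε₀) ≤ _)
          linarith
        have h4 := pow_le_pow_left₀ (Real.sqrt_nonneg _) h3 2
        rwa [Real.sq_sqrt (by positivity)] at h4

theorem resolv_conj {H : E →L[ℂ] E} (hH : IsSelfAdjoint H) (z : ℂ) :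
    resolv H (star z) = star (resolv H z) := by
  rw [resolv, resolv, ← Ring.inverse_star, star_sub, star_smul, hH.star_eq, star_one]

end LimitingAbsorption

end Mourre

theorem mainTheorem8 {E : Type*} [NormedAddCommGroup E] [InnerProductSpace ℂ E] [CompleteSpace E]
    (A : E →ₗ.[ℂ] E) (hA : IsSelfAdjoint A)
    (H : E →L[ℂ] E) (hH : Mourre.IsOfClass A 2 H)
    (J : Set ℝ) (a : ℝ) (hM : Mourre.MourreEstimate H A J a)
    (α β δ : ℝ) (hαβ : α ≤ β) (hδ : 0 < δ)
    (hI : Set.Icc α β + Set.Icc (-δ) δ ⊆ J)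
    (ν : ℝ) (hν : 1 / 2 < ν)
    (c₁ c₂ c₃ ε₀ : ℝ)
    (hc₁ : c₁ = ‖H‖ + ‖Mourre.commutator H A‖ + (1 + 4 / a) * ‖Mourre.commutator H A‖ ^ 2
      + ‖Mourre.commutator (Mourre.commutator H A) A‖ + a + |α| + |β| + 1)
    (hc₂ : c₂ = √(2 / a) + 1 / δ * √(8 * c₁ / a))
    (hc₃ : c₃ = 4 * c₂ + 2 * c₁ * c₂ ^ 2)
    (hε₀ : ε₀ = min (√a * δ / (4 * c₁)) (δ ^ 2 / (16 * c₁ ^ 2))) :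
    Mourre.IsCommutator A H (Mourre.commutator H A) ∧
    Mourre.IsCommutator A (Mourre.commutator H A)
      (Mourre.commutator (Mourre.commutator H A) A) ∧
    ∀ lam ∈ Set.Icc α β, ∀ μ ∈ Set.Ioo (0 : ℝ) 1,
      ∀ z : ℂ, (z = (lam : ℂ) + Complex.I * μ ∨ z = (lam : ℂ) - Complex.I * μ) →
        z ∈ resolventSet ℂ H ∧
        ‖Mourre.japNegPow A ν * Mourre.resolv H z * Mourre.japNegPow A ν‖
          ≤ (√(4 / (a * ε₀) + c₃ * ε₀ ^ ν / ν)
              + c₃ * ε₀ ^ (ν - 1 / 2) / (ν - 1 / 2)) ^ 2 * Real.exp (c₃ * ε₀) := by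
  obtain ⟨h1, h2⟩ := hH.isCommutator hA
  refine ⟨h1, h2, fun lam hlam μ hμ z hz => ?_⟩
  have hsa := hH.1
  have ha := hM.pos
  have hμ0 : 0 < μ := hμ.1
  have hzim : z.im ≠ 0 := by
    rcases hz with rfl | rfl <;> simpa using hμ0.ne'
  refine ⟨?_, ?_⟩
  · have h3 := (Mourre.isUnit_sub_smul_one hsa hzim).neg
    rw [neg_sub, ← Algebra.algebraMap_eq_smul_one] at h3
    exact h3
  -- On the zero space the Mourre estimate is void and gives no bound on δ, so this case is
  -- separated.
  rcases subsingleton_or_nontrivial E with hE | hE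
  · have : Mourre.japNegPow A ν * Mourre.resolv H z * Mourre.japNegPow A ν = 0 :=
      ContinuousLinearMap.ext fun x => Subsingleton.elim _ _
    rw [this, norm_zero]
    positivity
  set C := Mourre.commutator H A with hC
  set C₂ := Mourre.commutator C A with hC₂
  have hIl : Set.Icc (lam - δ) (lam + δ) ⊆ J := fun x hx =>
    hI (Set.mem_add.2 ⟨lam, hlam, x - lam, ⟨by linarith [hx.1], by linarith [hx.2]⟩, by ring⟩)
  have hδle := hM.le_norm_add_abs hA h1 hδ hIl
  have hlamle : |lam| ≤ |α| + |β| := by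
    refine abs_le.2 ⟨?_, ?_⟩
    · linarith [hlam.1, neg_abs_le α, abs_nonneg β]
    · linarith [hlam.2, le_abs_self β, abs_nonneg α]
  have hHn := norm_nonneg H
  have hCn := norm_nonneg C
  have hC₂n := norm_nonneg C₂
  have h4a : 0 ≤ 4 / a * ‖C‖ ^ 2 := by positivity
  have hα := abs_nonneg α
  have hβ := abs_nonneg β
  have hsq : ‖C‖ ≤ ‖C‖ ^ 2 + 1 := by nlinarith [sq_nonneg (‖C‖ - 1)]
  -- The coefficient from `MourreEstimate.le_re_inner`; κ = K/δ². The shape of c₁ is made for 2K ≤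
  -- c₁, with 2‖C‖ ≤ ‖C‖ + ‖C‖² + 1.
  set K := a / 2 + 2 / a * ‖C‖ ^ 2 + ‖C‖ with hK
  have hK0 : 0 ≤ K := by positivity
  have hKc : 2 * K ≤ c₁ := by
    have e : 2 * K = a + 4 / a * ‖C‖ ^ 2 + 2 * ‖C‖ := by rw [hK]; ring
    rw [e, hc₁]
    linarith
  have hc : Mourre.Constants a δ ‖C‖ ‖C₂‖ (2 * (K / δ ^ 2)) c₁ c₂ ε₀ :=
    { a_pos := ha
      δ_pos := hδ
      N_nonneg := hC₂n
      N_le := by rw [hc₁]; nlinarith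
      q_nonneg := by positivity
      q_le := by rw [← mul_div_assoc]; gcongr
      nC_sq_le := by rw [hc₁]; linarith
      a_le := by rw [hc₁]; nlinarith
      one_le := by rw [hc₁]; nlinarith
      δ_le := by rw [hc₁]; nlinarith
      c₂_eq := hc₂
      ε₀_eq := hε₀ }
  have hstar : star C = -C := by
    have h3 := (Mourre.isCommutator_iff.1 h1).isSelfAdjoint hA hsa
    rw [isSelfAdjoint_iff, star_neg, star_smul, Complex.star_def, Complex.conj_I, neg_smul, neg_neg,
      ← smul_neg] at h3
    exact smul_right_injective _ Complex.I_ne_zero h3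
  have hd : Mourre.EnergyData H C a (K / δ ^ 2) lam μ ε₀ :=
    { selfAdjoint := hsa
      star_eq := hstar
      a_pos := ha
      κ_nonneg := by positivity
      μ_pos := hμ0
      mourre := fun y => by
        have h6 := hM.le_re_inner y
        rw [← hC, ← hK] at h6
        have h3 := Mourre.norm_sub_spectralMeasure_apply_le hsa hM.isOpen hδ hIl y
        have h4 := pow_le_pow_left₀ (by positivity) h3 2
        have h5 : K * ‖y - Mourre.spectralMeasure H J y‖ ^ 2
            ≤ K / δ ^ 2 * ‖H y - (lam : ℂ) • y‖ ^ 2 := by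
          calc _ = K / δ ^ 2 * (δ * ‖y - Mourre.spectralMeasure H J y‖) ^ 2 := by field_simp
            _ ≤ _ := by gcongr
        linarith
      small := hc.small }
  have key := hd.norm_weighted_resolv_le hA h1 h2 (Mourre.isInvOneAddSq_invOneAddSq hA) rfl hc hν
  rw [← hc₃] at key
  rcases hz with rfl | rfl
  · exact key
  -- The weights are self-adjoint, so the weighted resolvent at the conjugate point is the adjoint
  -- and has the same norm.
  · have e : (lam : ℂ) - Complex.I * μ = star ((lam : ℂ) + Complex.I * μ) := by
      simp [sub_eq_add_neg]
    have hD : IsSelfAdjoint (Mourre.japNegPow A ν) := cfc_predicate _ _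
    have e2 : Mourre.japNegPow A ν * star (Mourre.resolv H (lam + Complex.I * μ))
        * Mourre.japNegPow A ν = star (Mourre.japNegPow A ν
          * Mourre.resolv H (lam + Complex.I * μ) * Mourre.japNegPow A ν) := by
      rw [star_mul, star_mul, hD.star_eq, mul_assoc]
    rw [e, Mourre.resolv_conj hsa, e2, norm_star]
    exact key
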